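/- For integers $n\ge 1$, $N\ge 2$, $\ell\ge 0$ and a real weight function $D$ on $\mathbb{Z}$, an input of search $\mathrm{EDCP}_{n,N,D}^{\ell}$ with secret $\mathbf{s}\in\mathbb{Z}_N^n$ consists of $\ell$ quantum states, the normalizations of $\sum_{j\in\mathbb{Z}} D(j)\,|j\rangle|\mathbf{x}_k+j\mathbf{s} \bmod N\rangle$ $(1\le k\le \ell)$, with arbitrary $\mathbf{x}_k\in\mathbb{Z}_N^n$; the task is to output $\mathbf{s}$. $\mathrm{U\text{-}EDCP}_{n,N,M}^{\ell}$ is the case where $D$ is the indicator function of $\{0,\dots,M-1\}$, and $\mathrm{G\text{-}EDCP}_{n,N,r}^{\ell}$ is the case $D(j)=\rho_r(j)=\exp(-\pi j^2/r^2)$. **Lemma (U-EDCP $\le$ G-EDCP).** Let $n\ge 1$ and let $N,M,\ell$ be integers greater than $1$, let $\kappa\ge 1$ be an integer and let $r$ be a real number such that $M=\sqrt{\kappa}\cdot r=\mathrm{poly}(\kappa)$. Then there is a probabilistic (quantum) reduction with run time polynomial in $\kappa$ from $\mathrm{U\text{-}EDCP}_{n,N,M}^{\ell}$ to $\mathrm{G\text{-}EDCP}_{n,N,r}^{O(\ell/\kappa^{1.5})}$.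 Precisely: there is one quantum algorithm with classical control (a fixed program that takes $\kappa,n,N,M,\ell,\ell'$ as classical inputs and may compute rotation angles with real numbers) such that for all $d\in\mathbb{N}$ and $C>0$ there are a polynomial $p$ and constants $A$ and $a>0$ with the following property. Let $\kappa,n,N,M,\ell,r$ be as above with $M\le\kappa^d+d$, and let $\ell'\ge 0$ be an integer with $\ell'\le C\,\ell/\kappa^{1.5}$. Started on the $\ell$ states of any $\mathrm{U\text{-}EDCP}_{n,N,M}^{\ell}$ input with secret $\mathbf{s}$, the algorithm makes at most $\ell\cdot p(\kappa)$ steps, whatever the outcomes of its measurements, and selects registers that it hands to a solver for $\mathrm{G\text{-}EDCP}_{n,N,r}^{\ell'}$; the solver's answer is the output of the reduction. If the solver is any quantum algorithm that outputs $\mathbf{s}$ with probability at least $\delta$ on every $\mathrm{G\text{-}EDCP}_{n,N,r}^{\ell'}$ input with secret $\mathbf{s}$, then the reduction outputs $\mathbf{s}$ with probability at least $\delta-A(\ell'+1)2^{-a\kappa}$. -/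

import Mathlib

namespace EDCP

/-! ### The extrapolated dihedral coset problem -/

/-- The vectors of `ℤ_N^n`. -/
abbrev Vect (n N : ℕ) : Type := Fin n → ZMod N

/-- Basis labels `(j, y)` of one sample register `|j⟩|y⟩`. -/
abbrev Label (n N : ℕ) : Type := ℤ × Vect n N

/-- The Hilbert space of `ℓ` sample registers, with orthonormal basis
`|j₁⟩|y₁⟩ ⋯ |j_ℓ⟩|y_ℓ⟩`. -/
abbrev Samples (n N ℓ : ℕ) : Type := lp (fun _ : Fin ℓ → Label n N => ℂ) 2

/-- The amplitude at `(j, y)` of the normalized sample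
`(∑ j, D j ^ 2)^(-1/2) * ∑ j, D j |j⟩|x + j s⟩`. -/
noncomputable def sampleAmp {n N : ℕ} (D : ℤ → ℝ) (x s : Vect n N) (b : Label n N) : ℂ :=
  if b.2 = x + b.1 • s then ((D b.1 / √(∑' j, D j ^ 2) : ℝ) : ℂ) else 0

theorem summable_sampleAmp {n N : ℕ} (D : ℤ → ℝ) (x s : Vect n N) :
    Summable fun b : Label n N => ‖sampleAmp D x s b‖ ^ 2 := by
  have hinj : Function.Injective fun j : ℤ => ((j, x + j • s) : Label n N) :=
    fun a b h => congrArg Prod.fst h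
  rw [← hinj.summable_iff]
  · by_cases hD : Summable fun j => D j ^ 2
    · refine (hD.div_const ((√(∑' j, D j ^ 2)) ^ 2)).congr fun j => ?_
      simp [sampleAmp, div_pow]
    · simp [Function.comp_def, sampleAmp, tsum_eq_zero_of_not_summable hD]
  · rintro ⟨j, y⟩ hy
    have : y ≠ x + j • s := fun h => hy ⟨j, by simp [h]⟩
    have h0 : sampleAmp D x s ((j, y) : Label n N) = 0 := if_neg this
    rw [h0, norm_zero, zero_pow two_ne_zero]

theorem memℓp_prod_sampleAmp {n N ℓ : ℕ} (D : ℤ → ℝ) (x : Fin ℓ → Vect n N) (s : Vect n N) :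
    Memℓp (fun h : Fin ℓ → Label n N => ∏ k, sampleAmp D (x k) s (h k)) 2 := by
  classical
  refine memℓp_gen ?_
  simp only [ENNReal.toReal_ofNat, Real.rpow_ofNat, norm_prod, ← Finset.prod_pow]
  refine summable_of_sum_le (c := ∏ k, ∑' b, ‖sampleAmp D (x k) s b‖ ^ 2)
    (fun h => by positivity) fun S => ?_
  calc ∑ h ∈ S, ∏ k, ‖sampleAmp D (x k) s (h k)‖ ^ 2
      ≤ ∑ h ∈ Fintype.piFinset (fun k => S.image fun h => h k),
          ∏ k, ‖sampleAmp D (x k) s (h k)‖ ^ 2 := by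
        refine Finset.sum_le_sum_of_subset_of_nonneg (fun h hh => ?_) fun _ _ _ => by positivity
        exact Fintype.mem_piFinset.2 fun k => Finset.mem_image_of_mem _ hh
    _ = ∏ k, ∑ b ∈ S.image (fun h => h k), ‖sampleAmp D (x k) s b‖ ^ 2 :=
        (Finset.prod_univ_sum (fun k => S.image fun h => h k)
          fun k b => ‖sampleAmp D (x k) s b‖ ^ 2).symm
    _ ≤ ∏ k, ∑' b, ‖sampleAmp D (x k) s b‖ ^ 2 :=
        Finset.prod_le_prod (fun _ _ => by positivity) fun k _ =>
          (summable_sampleAmp D (x k) s).sum_le_tsum _ fun _ _ => by positivity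

/-- The input of search `EDCP_{n,N,D}^ℓ`: the product of `ℓ` normalized samples
`∑ j, D j |j⟩|x_k + j s⟩` with a common secret `s`. -/
noncomputable def inputState {n N ℓ : ℕ} (D : ℤ → ℝ) (x : Fin ℓ → Vect n N) (s : Vect n N) :
    Samples n N ℓ :=
  ⟨fun h => ∏ k, sampleAmp D (x k) s (h k), memℓp_prod_sampleAmp D x s⟩

/-- The amplitudes of `U-EDCP_{n,N,M}`: uniform on `{0, …, M - 1}`. -/
noncomputable def uniformWeight (M : ℕ) (j : ℤ) : ℝ := if 0 ≤ j ∧ j < M then 1 else 0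

/-- The amplitudes of `G-EDCP_{n,N,r}`: the Gaussian `ρ_r`. -/
noncomputable def gaussianWeight (r : ℝ) (j : ℤ) : ℝ := Real.exp (-Real.pi * (j : ℝ) ^ 2 / r ^ 2)

/-- An arbitrary quantum algorithm that is given `ℓ` sample registers and outputs a vector of
`ℤ_N^n` or fails: the measurement it performs on its input. `op s` is the operator of the
outcome `s`; the rest of the identity belongs to failure. -/
structure Solver (n N ℓ : ℕ) where
  op : Vect n N → (Samples n N ℓ →L[ℂ] Samples n N ℓ)
  pos : ∀ s, (op s).IsPositive
  sum_le : ∀ S : Finset (Vect n N), (1 - ∑ s ∈ S, op s).IsPositive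

/-- The quantity `⟨Φ, op s Φ⟩`; for a unit vector `Φ` it is the probability that the algorithm
outputs `s` on input `Φ`. -/
noncomputable def Solver.prob {n N ℓ : ℕ} (Q : Solver n N ℓ) (s : Vect n N)
    (Φ : Samples n N ℓ) : ℝ :=
  (Q.op s).reApplyInnerSelf Φ

/-! ### Quantum programs with classical control

A machine has classical integer registers `v 0, v 1, …`, a quantum memory whose registers
`q (row, column)` hold integers, and a write-only list of selected rows. A program is a fixed
finite text, independent of all parameters. Integers are only added, subtracted and compared, so
that their bit lengths grow at most linearly with the number of steps and unit cost per
instruction is polynomially equivalent to bit cost. Angles of rotations are given by closed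
formulas in the classical registers, computed with real numbers. -/

/-- Formulas for real numbers. `var a` is the value of the classical register `a`. -/
inductive RExp : Type
  | int (z : ℤ)
  | var (a : ℕ)
  | pi
  | add (e f : RExp)
  | mul (e f : RExp)
  | div (e f : RExp)
  | sqrt (e : RExp)
  | exp (e : RExp)
  | arccos (e : RExp)

noncomputable def RExp.eval (v : ℕ → ℤ) : RExp → ℝ
  | int z => z
  | var a => v a
  | pi => Real.pi
  | add e f => e.eval v + f.eval v
  | mul e f => e.eval v * f.eval v
  | div e f => e.eval v / f.eval v
  | sqrt e => √(e.eval v)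
  | exp e => Real.exp (e.eval v)
  | arccos e => Real.arccos (e.eval v)

/-- A reference to a quantum register: the names of the classical registers that hold its row
and its column. -/
structure QRef where
  row : ℕ
  col : ℕ

/-- The address of the quantum register that is referred to. -/
def QRef.addr (v : ℕ → ℤ) (R : QRef) : ℕ × ℕ := ((v R.row).toNat, (v R.col).toNat)

inductive Prog : Type
  /-- first `p`, then `p'` -/
  | seq (p p' : Prog)
  /-- `v a := z` -/
  | set (a : ℕ) (z : ℤ)
  /-- `v a := v a + v b` -/
  | add (a b : ℕ)
  /-- `v a := v a - v b` -/
  | sub (a b : ℕ)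
  /-- if `v a ≤ v b` then `p` else `p'` -/
  | ite (a b : ℕ) (p p' : Prog)
  /-- repeat `p`, as many times as the value of `v a` at the start (never if it is negative) -/
  | loop (a : ℕ) (p : Prog)
  /-- `q R := q R + v a` -/
  | qshift (R : QRef) (a : ℕ)
  /-- `q R := q R + q S` -/
  | qadd (R S : QRef)
  /-- `q R := q R - q S` -/
  | qsub (R S : QRef)
  /-- if `q S = v a`, rotate the plane of `|0⟩, |1⟩` of `q R` by the angle `θ` -/
  | rotate (R S : QRef) (a : ℕ) (θ : RExp)
  /-- if `q S = v a`, multiply by the phase `exp (i θ)` -/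
  | phase (S : QRef) (a : ℕ) (θ : RExp)
  /-- measure `q R` and store the outcome in `v a` -/
  | measure (R : QRef) (a : ℕ)
  /-- append the row number `v a` to the list of selected rows -/
  | select (a : ℕ)

/-- The basis states of the quantum memory: an integer for every register. -/
abbrev Mem : Type := ℕ × ℕ → ℤ

/-- A state of the machine along one sequence of measurement outcomes. The squared norm of `amp`
is the probability of that sequence. -/
structure State where
  v : ℕ → ℤ
  sel : List ℕ
  amp : Mem →₀ ℂ
  time : ℕ

/-- One unit of time passes. -/
def State.tick (σ : State) : State := { σ with time := σ.time + 1 }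

/-- The basis state `|m⟩` after `q R := q R + z`. -/
def Mem.shift (m : Mem) (R : ℕ × ℕ) (z : ℤ) : Mem := Function.update m R (m R + z)

/-- The rotation by `t` in the plane of `|0⟩, |1⟩` of register `R`, applied to `|m⟩`. -/
noncomputable def rotateBasis (R : ℕ × ℕ) (t : ℝ) (m : Mem) : Mem →₀ ℂ :=
  if m R = 0 then
    Finsupp.single m (Real.cos t : ℂ) + Finsupp.single (Function.update m R 1) (Real.sin t : ℂ)
  else if m R = 1 then
    Finsupp.single m (Real.cos t : ℂ) - Finsupp.single (Function.update m R 0) (Real.sin t : ℂ)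
  else Finsupp.single m 1

/-- All possible final states of a program, one for each sequence of measurement outcomes. A
quantum instruction with `R = S` would not be unitary and does nothing. -/
noncomputable def exec : Prog → State → Multiset State
  | .seq p p', σ => (exec p σ).bind (exec p')
  | .set a z, σ => {{ σ.tick with v := Function.update σ.v a z }}
  | .add a b, σ => {{ σ.tick with v := Function.update σ.v a (σ.v a + σ.v b) }}
  | .sub a b, σ => {{ σ.tick with v := Function.update σ.v a (σ.v a - σ.v b) }}
  | .ite a b p p', σ => if σ.v a ≤ σ.v b then exec p σ.tick else exec p' σ.tick
  | .loop a p, σ =>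
      (fun B : Multiset State => B.bind fun τ => exec p τ.tick)^[(σ.v a).toNat] {σ.tick}
  | .qshift R a, σ =>
      {{ σ.tick with amp := σ.amp.mapDomain fun m => m.shift (R.addr σ.v) (σ.v a) }}
  | .qadd R S, σ =>
      if R.addr σ.v = S.addr σ.v then {σ.tick}
      else {{ σ.tick with
        amp := σ.amp.mapDomain fun m => m.shift (R.addr σ.v) (m (S.addr σ.v)) }}
  | .qsub R S, σ =>
      if R.addr σ.v = S.addr σ.v then {σ.tick}
      else {{ σ.tick with
        amp := σ.amp.mapDomain fun m => m.shift (R.addr σ.v) (-m (S.addr σ.v)) }}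
  | .rotate R S a θ, σ =>
      if R.addr σ.v = S.addr σ.v then {σ.tick}
      else {{ σ.tick with
        amp := Finsupp.linearCombination ℂ (fun m =>
          if m (S.addr σ.v) = σ.v a then rotateBasis (R.addr σ.v) (θ.eval σ.v) m
          else Finsupp.single m 1) σ.amp }}
  | .phase S a θ, σ =>
      {{ σ.tick with
        amp := Finsupp.linearCombination ℂ (fun m =>
          if m (S.addr σ.v) = σ.v a then
            Finsupp.single m (Complex.exp ((θ.eval σ.v : ℂ) * Complex.I))
          else Finsupp.single m 1) σ.amp }}
  | .measure R a, σ =>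
      (σ.amp.support.image fun m => m (R.addr σ.v)).val.map fun z =>
        { σ.tick with
          v := Function.update σ.v a z
          amp := σ.amp.filter fun m => m (R.addr σ.v) = z }
  | .select a, σ => {{ σ.tick with sel := σ.sel ++ [(σ.v a).toNat] }}

/-! ### Reductions between sample problems

A program is started with the samples in the rows `0, …, ℓ - 1` of the quantum memory, and it
selects `ℓ'` distinct rows. The samples in these rows are then handed to a solver, whose answer is
the answer of the reduction. -/

/-- The basis state of the memory that holds the labels `h k = (j, y)` in its rows: `j` in column
`0`, the entries of `y` (as integers in `[0, N)`) in the columns `1, …, n`, and `0` elsewhere. -/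
def load {n N ℓ : ℕ} (h : Fin ℓ → Label n N) : Mem := fun a =>
  if hk : a.1 < ℓ then
    if a.2 = 0 then (h ⟨a.1, hk⟩).1
    else if hi : a.2 - 1 < n then (((h ⟨a.1, hk⟩).2 ⟨a.2 - 1, hi⟩).val : ℤ) else 0
  else 0

/-- The machine at the start: the classical inputs `κ, n, N, M, ℓ, ℓ'` are in the registers
`v 0, …, v 5`, and the state `Φ` of `ℓ` sample registers (with finitely many nonzero amplitudes)
is in the quantum memory. -/
noncomputable def initial {n N ℓ : ℕ} (κ M ℓ' : ℕ) (Φ : Samples n N ℓ) : State where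
  v := fun a => (([κ, n, N, M, ℓ, ℓ'].getD a 0 : ℕ) : ℤ)
  sel := []
  amp := ∑ᶠ h : Fin ℓ → Label n N, Finsupp.single (load h) (Φ h)
  time := 0

/-- The basis state `m` with the registers of the samples in the rows `R k` erased. -/
noncomputable def eraseRows {ℓ : ℕ} (n : ℕ) (R : Fin ℓ → ℕ) (m : Mem) : Mem :=
  open Classical in fun a => if (∃ k, R k = a.1) ∧ a.2 ≤ n then 0 else m a

/-- The rows `R k` of the basis state `m` hold labels of samples. -/
def HoldsLabels {ℓ : ℕ} (n N : ℕ) (R : Fin ℓ → ℕ) (m : Mem) : Prop :=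
  ∀ k, ∀ i : Fin n, 0 ≤ m (R k, i + 1) ∧ m (R k, i + 1) < N

/-- The labels that the rows `R k` of the basis state `m` hold. -/
def labels {ℓ : ℕ} (n N : ℕ) (R : Fin ℓ → ℕ) (m : Mem) : Fin ℓ → Label n N :=
  fun k => (m (R k, 0), fun i => (m (R k, i + 1) : ZMod N))

/-- The component `Φ_g` of the state `ψ = ∑ g, Φ_g ⊗ |g⟩`, with `Φ_g` a state of the sample
registers in the distinct rows `R k` and `g` a basis state of all other registers. -/
noncomputable def component {ℓ : ℕ} (n N : ℕ) (R : Fin ℓ → ℕ) (ψ : Mem →₀ ℂ) (g : Mem) :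
    Samples n N ℓ :=
  open Classical in
  ∑ m ∈ ψ.support with eraseRows n R m = g ∧ HoldsLabels n N R m,
    ψ m • lp.single 2 (labels n N R m) (1 : ℂ)

/-- The probability that the sequence of measurement outcomes that led to `σ` occurs, exactly `ℓ`
distinct rows have been selected, and the solver outputs `s` when it is given these rows. -/
noncomputable def answerProb {n N ℓ : ℕ} (Q : Solver n N ℓ) (s : Vect n N) (σ : State) : ℝ :=
  open Classical in
  if σ.sel.length = ℓ ∧ σ.sel.Nodup then
    let R : Fin ℓ → ℕ := fun k => σ.sel.getD k 0
    ∑ g ∈ σ.amp.support.image (eraseRows n R), Q.prob s (component n N R σ.amp g)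
  else 0

/-- The probability that the reduction given by the program `P` and the solver `Q` outputs `s`
when it is started in the state `σ`. -/
noncomputable def reductionProb {n N ℓ : ℕ} (P : Prog) (Q : Solver n N ℓ) (s : Vect n N)
    (σ : State) : ℝ :=
  ((exec P σ).map (answerProb Q s)).sum

end EDCP

namespace EDCP

open Finset

/-! The reduction is quantum rejection sampling, one sample at a time. Subtracting `⌊M/2⌋` from the
label moves the window `{0, …, M - 1}` to one centred at `0`, at the price of replacing `x` by `x +
⌊M/2⌋ s`, which is harmless because base points are arbitrary. An ancilla is rotated by `arccos
ρ_r(j)`, controlled on the centred label `j`, and measured. Outcome `0` multiplies each amplitude by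
`ρ_r(j)`, so the sample becomes a Gaussian sample cut off to the window; outcome `1` spoils it. The
real `r` is not an input, but `π j² / r² = π κ j² / M²` is computable.

Write `S` for the sum of `ρ_r(j)²` over the window. A sample is accepted with probability `p = S /
M`. Since `S` is at least a constant times `r` and `M = √κ r`, `p` is at least a constant over `√κ`
(`le_acceptProb`). Hence `ℓ` samples give about `ℓ / √κ` accepted ones, and `ℓ' ≤ C ℓ / κ^1.5`
leaves a factor of order `κ` to spare. A moment bound with `2^(-X)`, `X` the number of accepted
samples, then makes a shortage exponentially unlikely in `κ` (`le_sum_answerProb_loop`,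
`min_one_failure_le`).

The cut-off is at about `√κ r / 2`, so it removes only a fraction `√2 exp(-πκ/4)` of the squared
Gaussian mass, by the functional equation of the theta function
(`one_sub_le_tsum_truncWeight_sq_div`). Thus `ℓ'` truncated samples are close in norm to `ℓ'`
Gaussian ones, and the answer probability of a solver changes by at most twice that distance
(`Solver.prob_sub_le`).

To tie this to the machine, an invariant (`Progress`) is carried through the loop: after `k` rows
the memory is a product state with explicit real row weights, whose squared norm is the probability
of the outcomes so far. At the end the selected rows factor off from the rest of the memory, so the
solver sees exactly truncated Gaussian samples (`le_answerProb`). -/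

/-! ### Truncated Gaussian weights -/

/-- The Gaussian weight, cut off to the `M` integers from `-⌊M/2⌋` to `M - 1 - ⌊M/2⌋`. -/
noncomputable def truncWeight (M : ℕ) (r : ℝ) (j : ℤ) : ℝ :=
  if 0 ≤ j + (M / 2 : ℕ) ∧ j + (M / 2 : ℕ) < M then gaussianWeight r j else 0

theorem gaussianWeight_pos (r : ℝ) (j : ℤ) : 0 < gaussianWeight r j := Real.exp_pos _

theorem gaussianWeight_le_one (r : ℝ) (j : ℤ) : gaussianWeight r j ≤ 1 := by
  refine Real.exp_le_one_iff.2 ?_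
  rw [neg_mul, neg_div]
  exact neg_nonpos.2 (by positivity)

theorem gaussianWeight_sq (r : ℝ) (j : ℤ) :
    gaussianWeight r j ^ 2 = Real.exp (-Real.pi * (2 / r ^ 2) * (j : ℝ) ^ 2) := by
  rw [gaussianWeight, ← Real.exp_nat_mul]
  congr 1
  push_cast
  ring

theorem summable_exp_neg_pi_mul_int_sq {a : ℝ} (ha : 0 < a) :
    Summable fun j : ℤ => Real.exp (-Real.pi * a * (j : ℝ) ^ 2) := by
  -- The bound for the terms of the Jacobi theta function, without linear part and without power
  -- factor.
  refine (summable_pow_mul_jacobiTheta₂_term_bound 0 ha 0).congr fun j => ?_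
  simp [mul_assoc]

theorem summable_gaussianWeight_sq {r : ℝ} (hr : 0 < r) :
    Summable fun j => gaussianWeight r j ^ 2 := by
  simp only [gaussianWeight_sq]
  exact summable_exp_neg_pi_mul_int_sq (by positivity)

/-- Halving the variance of a Gaussian sum loses at most a factor `√2`. -/
theorem tsum_exp_neg_pi_le {a : ℝ} (ha : 0 < a) :
    ∑' j : ℤ, Real.exp (-Real.pi * a * (j : ℝ) ^ 2) ≤
      √2 * ∑' j : ℤ, Real.exp (-Real.pi * (2 * a) * (j : ℝ) ^ 2) := by
  -- Poisson summation turns the parameters `a` and `2a` into `1/a` and `1/(2a)`. The dual sums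
  -- compare termwise in the wanted direction, and the prefactors `1/√a` and `1/√(2a)` differ by
  -- `√2`.
  rw [Real.tsum_exp_neg_mul_int_sq ha, Real.tsum_exp_neg_mul_int_sq (by positivity : 0 < 2 * a),
    ← Real.sqrt_eq_rpow, ← Real.sqrt_eq_rpow, Real.sqrt_mul zero_le_two]
  have h : ∀ b : ℝ, -Real.pi / b = -Real.pi * (1 / b) := fun b => by ring
  simp only [h]
  have h1 : ∑' j : ℤ, Real.exp (-Real.pi * (1 / a) * (j : ℝ) ^ 2) ≤
      ∑' j : ℤ, Real.exp (-Real.pi * (1 / (2 * a)) * (j : ℝ) ^ 2) := by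
    refine Summable.tsum_le_tsum (fun j => ?_) (summable_exp_neg_pi_mul_int_sq (by positivity))
      (summable_exp_neg_pi_mul_int_sq (by positivity))
    rw [Real.exp_le_exp]
    have : 1 / (2 * a) ≤ 1 / a := one_div_le_one_div_of_le ha (by linarith)
    have hp : 0 ≤ Real.pi * (j : ℝ) ^ 2 := by positivity
    nlinarith
  have hs : √2 ≠ 0 := by positivity
  calc _ ≤ 1 / √a * ∑' j : ℤ, Real.exp (-Real.pi * (1 / (2 * a)) * (j : ℝ) ^ 2) := by gcongr
    _ = _ := by field_simp

theorem truncWeight_nonneg (M : ℕ) (r : ℝ) (j : ℤ) : 0 ≤ truncWeight M r j := by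
  rw [truncWeight]
  split_ifs
  · exact (gaussianWeight_pos r j).le
  · rfl

theorem truncWeight_le (M : ℕ) (r : ℝ) (j : ℤ) : truncWeight M r j ≤ gaussianWeight r j := by
  rw [truncWeight]
  split_ifs
  · rfl
  · exact (gaussianWeight_pos r j).le

theorem truncWeight_fin (M : ℕ) (r : ℝ) (a : Fin M) :
    truncWeight M r ((a : ℤ) - (M / 2 : ℕ)) = gaussianWeight r ((a : ℤ) - (M / 2 : ℕ)) :=
  if_pos (by have := a.2; constructor <;> lia)

theorem truncWeight_eq_zero {M : ℕ} (r : ℝ) {j : ℤ}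
    (hj : ∀ a : Fin M, (a : ℤ) - (M / 2 : ℕ) ≠ j) : truncWeight M r j = 0 := by
  refine if_neg fun h => hj ⟨(j + (M / 2 : ℕ)).toNat, by lia⟩ ?_
  simp only
  lia

theorem summable_truncWeight_sq {r : ℝ} (hr : 0 < r) (M : ℕ) :
    Summable fun j => truncWeight M r j ^ 2 :=
  (summable_gaussianWeight_sq hr).of_nonneg_of_le (fun _ => by positivity) fun j =>
    pow_le_pow_left₀ (truncWeight_nonneg M r j) (truncWeight_le M r j) 2

theorem tsum_truncWeight_sq (M : ℕ) (r : ℝ) :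
    ∑' j, truncWeight M r j ^ 2 =
      ∑ a : Fin M, gaussianWeight r ((a : ℤ) - (M / 2 : ℕ)) ^ 2 := by
  have hinj : Function.Injective fun a : Fin M => (a : ℤ) - (M / 2 : ℕ) := fun a b h => by
    ext
    simpa using h
  rw [← hinj.tsum_eq, tsum_fintype]
  · simp only [truncWeight_fin]
  · intro j hj
    by_contra h
    refine hj ?_
    simp only [truncWeight_eq_zero r fun a ha => h ⟨a, ha⟩]
    norm_num

/-- The labels `-t` with `0 ≤ t ≤ r/2` suffice: there are at least `r/2` of them and each has
squared weight at least `exp(-π/2)`. The negative side is used because the window reaches down to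
`-⌊M/2⌋` but, for even `M`, only up to `M/2 - 1`. -/
theorem le_tsum_truncWeight_sq {M : ℕ} {r : ℝ} (hr : 0 < r) (hM : r ≤ M) :
    Real.exp (-(Real.pi / 2)) / 2 * r ≤ ∑' j, truncWeight M r j ^ 2 := by
  have hle : ⌊r / 2⌋₊ ≤ M / 2 := by
    rw [← Nat.floor_div_eq_div (K := ℝ)]
    exact Nat.floor_le_floor (by push_cast; linarith)
  have hM0 : 0 < M := by exact_mod_cast hr.trans_le hM
  have hterm : ∀ t ∈ range (⌊r / 2⌋₊ + 1),
      Real.exp (-(Real.pi / 2)) ≤ truncWeight M r (-(t : ℤ)) ^ 2 := fun t ht => by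
    have ht' : t ≤ ⌊r / 2⌋₊ := Nat.lt_succ_iff.1 (mem_range.1 ht)
    have h1 : truncWeight M r (-(t : ℤ)) = gaussianWeight r (-(t : ℤ)) := if_pos (by lia)
    have h2 : (t : ℝ) ≤ r / 2 := (Nat.cast_le.2 ht').trans (Nat.floor_le (by positivity))
    rw [h1, gaussianWeight_sq, Real.exp_le_exp]
    have h3 : (t : ℝ) ^ 2 ≤ (r / 2) ^ 2 := pow_le_pow_left₀ (by positivity) h2 2
    have h4 : 2 / r ^ 2 * (t : ℝ) ^ 2 ≤ 1 / 2 := by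
      calc 2 / r ^ 2 * (t : ℝ) ^ 2 ≤ 2 / r ^ 2 * (r / 2) ^ 2 := by gcongr
        _ = 1 / 2 := by field_simp
    push_cast
    nlinarith [Real.pi_pos]
  have hinj : Function.Injective fun t : ℕ => -(t : ℤ) := fun a b h => by simpa using h
  calc Real.exp (-(Real.pi / 2)) / 2 * r = (r / 2) * Real.exp (-(Real.pi / 2)) := by ring
    _ ≤ ((⌊r / 2⌋₊ + 1 : ℕ) : ℝ) * Real.exp (-(Real.pi / 2)) := by
        gcongr
        push_cast
        exact (Nat.lt_floor_add_one _).le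
    _ = ∑ t ∈ range (⌊r / 2⌋₊ + 1), Real.exp (-(Real.pi / 2)) := by simp
    _ ≤ ∑ t ∈ range (⌊r / 2⌋₊ + 1), truncWeight M r (-(t : ℤ)) ^ 2 := sum_le_sum hterm
    _ = ∑ j ∈ (range (⌊r / 2⌋₊ + 1)).map ⟨_, hinj⟩, truncWeight M r j ^ 2 := by simp
    _ ≤ _ := (summable_truncWeight_sq hr M).sum_le_tsum _ fun _ _ => by positivity

theorem tsum_truncWeight_sq_le {r : ℝ} (hr : 0 < r) (M : ℕ) :
    ∑' j, truncWeight M r j ^ 2 ≤ ∑' j, gaussianWeight r j ^ 2 :=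
  (summable_truncWeight_sq hr M).tsum_le_tsum
    (fun j => pow_le_pow_left₀ (truncWeight_nonneg M r j) (truncWeight_le M r j) 2)
    (summable_gaussianWeight_sq hr)

theorem tsum_gaussianWeight_sq_pos {r : ℝ} (hr : 0 < r) : 0 < ∑' j, gaussianWeight r j ^ 2 :=
  (summable_gaussianWeight_sq hr).tsum_pos (fun _ => by positivity) 0
    (pow_pos (gaussianWeight_pos _ _) 2)

/-- The truncation loses an exponentially small part of the Gaussian. -/
theorem one_sub_le_tsum_truncWeight_sq_div {κ M : ℕ} {r : ℝ} (hr : 0 < r)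
    (hM : (M : ℝ) = √κ * r) :
    1 - √2 * Real.exp (-(Real.pi / 4 * κ)) ≤
      (∑' j, truncWeight M r j ^ 2) / ∑' j, gaussianWeight r j ^ 2 := by
  rw [le_div_iff₀ (tsum_gaussianWeight_sq_pos hr)]
  have hg := summable_gaussianWeight_sq hr
  have hs : Summable fun j : ℤ => Real.exp (-Real.pi * (1 / r ^ 2) * (j : ℝ) ^ 2) :=
    summable_exp_neg_pi_mul_int_sq (by positivity)
  -- Outside the window `|j| ≥ M/2`, so `π j²/r² ≥ πκ/4`. Half of the exponent `2π j²/r²` yields the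
  -- small factor; the other half stays summable and costs only `√2` by `tsum_exp_neg_pi_le`.
  have hterm : ∀ j : ℤ, gaussianWeight r j ^ 2 ≤ truncWeight M r j ^ 2 +
      Real.exp (-(Real.pi / 4 * κ)) * Real.exp (-Real.pi * (1 / r ^ 2) * (j : ℝ) ^ 2) := by
    intro j
    by_cases hj : 0 ≤ j + (M / 2 : ℕ) ∧ j + (M / 2 : ℕ) < M
    · rw [truncWeight, if_pos hj]
      exact le_add_of_nonneg_right (by positivity)
    · rw [truncWeight, if_neg hj, gaussianWeight_sq, ← Real.exp_add]
      have h1 : (M : ℤ) ≤ 2 * |j| := by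
        rcases abs_cases j with h | h <;> lia
      have h2 : (M : ℝ) ≤ 2 * |(j : ℝ)| := by exact_mod_cast h1
      have h3 : (M : ℝ) ^ 2 ≤ 4 * (j : ℝ) ^ 2 := by
        calc (M : ℝ) ^ 2 ≤ (2 * |(j : ℝ)|) ^ 2 := pow_le_pow_left₀ (by positivity) h2 2
          _ = 4 * (j : ℝ) ^ 2 := by rw [mul_pow, sq_abs]; norm_num
      have h4 : (κ : ℝ) * r ^ 2 ≤ 4 * (j : ℝ) ^ 2 := by
        rwa [hM, mul_pow, Real.sq_sqrt (Nat.cast_nonneg κ)] at h3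
      have h5 : (κ : ℝ) / 4 ≤ (j : ℝ) ^ 2 / r ^ 2 := by
        rw [div_le_div_iff₀ (by norm_num) (by positivity)]
        linarith
      have h6 := mul_le_mul_of_nonneg_left h5 Real.pi_pos.le
      have h7 : (0 : ℝ) ^ 2 = 0 := by norm_num
      rw [h7, zero_add, Real.exp_le_exp]
      have e1 : -Real.pi * (2 / r ^ 2) * (j : ℝ) ^ 2 = -2 * (Real.pi * ((j : ℝ) ^ 2 / r ^ 2)) := by
        ring
      have e2 : -Real.pi * (1 / r ^ 2) * (j : ℝ) ^ 2 = -(Real.pi * ((j : ℝ) ^ 2 / r ^ 2)) := by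
        ring
      rw [e1, e2]
      linarith
  have hsum := hg.tsum_le_tsum hterm ((summable_truncWeight_sq hr M).add (hs.mul_left _))
  rw [(summable_truncWeight_sq hr M).tsum_add (hs.mul_left _), tsum_mul_left] at hsum
  have htheta := tsum_exp_neg_pi_le (a := 1 / r ^ 2) (by positivity)
  have e : ∀ j : ℤ, Real.exp (-Real.pi * (2 * (1 / r ^ 2)) * (j : ℝ) ^ 2) =
      gaussianWeight r j ^ 2 := fun j => by rw [gaussianWeight_sq]; ring_nf
  simp only [e] at htheta
  have := mul_le_mul_of_nonneg_left htheta (Real.exp_pos (-(Real.pi / 4 * κ))).le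
  linarith

/-! ### Answer probabilities of a solver -/

theorem Solver.prob_nonneg {n N ℓ : ℕ} (Q : Solver n N ℓ) (s : Vect n N) (Φ : Samples n N ℓ) :
    0 ≤ Q.prob s Φ :=
  (Q.pos s).2 Φ

theorem Solver.prob_smul {n N ℓ : ℕ} (Q : Solver n N ℓ) (s : Vect n N) (c : ℂ)
    (Φ : Samples n N ℓ) : Q.prob s (c • Φ) = ‖c‖ ^ 2 * Q.prob s Φ :=
  ContinuousLinearMap.reApplyInnerSelf_smul _ _

/-- A positive operator below the identity is a contraction; the upper bound is `sum_le` for a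
single outcome. -/
theorem Solver.norm_op_le_one {n N ℓ : ℕ} (Q : Solver n N ℓ) (s : Vect n N) : ‖Q.op s‖ ≤ 1 := by
  refine (CStarAlgebra.norm_le_one_iff_of_nonneg (Q.op s)
    (ContinuousLinearMap.nonneg_iff_isPositive _ |>.2 (Q.pos s))).2 ?_
  have := Q.sum_le {s}
  rw [sum_singleton] at this
  rwa [ContinuousLinearMap.le_def]

/-- For a contraction `T`, `⟨TΦ, Φ⟩ - ⟨TΨ, Ψ⟩ = ⟨T(Φ - Ψ), Φ⟩ + ⟨TΨ, Φ - Ψ⟩`, and Cauchy–Schwarz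
bounds both terms. -/
theorem Solver.prob_sub_le {n N ℓ : ℕ} (Q : Solver n N ℓ) (s : Vect n N) {Φ Ψ : Samples n N ℓ}
    (hΦ : ‖Φ‖ ≤ 1) (hΨ : ‖Ψ‖ ≤ 1) : Q.prob s Φ - Q.prob s Ψ ≤ 2 * ‖Ψ - Φ‖ := by
  have hle : ∀ v, ‖Q.op s v‖ ≤ ‖v‖ := fun v =>
    ((Q.op s).le_of_opNorm_le (Q.norm_op_le_one s) v).trans_eq (one_mul _)
  have h1 : Q.prob s Φ - Q.prob s Ψ =
      RCLike.re (inner ℂ (Q.op s (Φ - Ψ)) Φ) + RCLike.re (inner ℂ (Q.op s Ψ) (Φ - Ψ)) := by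
    simp only [Solver.prob, ContinuousLinearMap.reApplyInnerSelf_apply, map_sub, inner_sub_left,
      inner_sub_right]
    ring
  have h2 := (RCLike.re_le_norm _).trans (norm_inner_le_norm (𝕜 := ℂ) (Q.op s (Φ - Ψ)) Φ)
  have h3 := (RCLike.re_le_norm _).trans (norm_inner_le_norm (𝕜 := ℂ) (Q.op s Ψ) (Φ - Ψ))
  have h4 := mul_le_mul (hle (Φ - Ψ)) hΦ (norm_nonneg _) (norm_nonneg _)
  have h5 := mul_le_mul ((hle Ψ).trans hΨ) le_rfl (norm_nonneg (Φ - Ψ)) zero_le_one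
  rw [h1, norm_sub_rev Ψ Φ]
  linarith

theorem Solver.prob_le_one {n N ℓ : ℕ} (Q : Solver n N ℓ) (s : Vect n N) {Φ : Samples n N ℓ}
    (hΦ : ‖Φ‖ ≤ 1) : Q.prob s Φ ≤ 1 := by
  rw [Solver.prob, ContinuousLinearMap.reApplyInnerSelf_apply]
  calc _ ≤ ‖Q.op s Φ‖ * ‖Φ‖ := (RCLike.re_le_norm _).trans (norm_inner_le_norm (𝕜 := ℂ) _ _)
    _ ≤ (1 * ‖Φ‖) * ‖Φ‖ := by
        gcongr
        exact (Q.op s).le_of_opNorm_le (Q.norm_op_le_one s) Φ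
    _ ≤ 1 := by
        rw [one_mul]
        exact mul_le_one₀ hΦ (norm_nonneg _) hΦ

/-! ### Norms and overlaps of product samples -/

theorem norm_sq_eq_tsum {ι : Type*} (Φ : lp (fun _ : ι => ℂ) 2) : ‖Φ‖ ^ 2 = ∑' h, ‖Φ h‖ ^ 2 := by
  have := lp.norm_rpow_eq_tsum (p := 2) (by norm_num) Φ
  simpa only [ENNReal.toReal_ofNat, Real.rpow_ofNat] using this

theorem sum_le_norm_sq {ι : Type*} (Φ : lp (fun _ : ι => ℂ) 2) (S : Finset ι) :
    ∑ h ∈ S, ‖Φ h‖ ^ 2 ≤ ‖Φ‖ ^ 2 := by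
  have := lp.sum_rpow_le_norm_rpow (p := 2) (by norm_num) Φ S
  simpa only [ENNReal.toReal_ofNat, Real.rpow_ofNat] using this

/-- Only an inequality, because for `D = 0` or `D` not square summable the normalizing sum is `0`
and division by zero gives the zero state. -/
theorem tsum_sampleAmp_le_one {n N : ℕ} (D : ℤ → ℝ) (x s : Vect n N) :
    ∑' b, ‖sampleAmp D x s b‖ ^ 2 ≤ 1 := by
  have hinj : Function.Injective fun j : ℤ => ((j, x + j • s) : Label n N) :=
    fun a b h => congrArg Prod.fst h
  rw [← hinj.tsum_eq]
  · have e : ∀ j : ℤ, ‖sampleAmp D x s (j, x + j • s)‖ ^ 2 = D j ^ 2 / ∑' j, D j ^ 2 := fun j => by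
      rw [sampleAmp, if_pos rfl, Complex.norm_real, Real.norm_eq_abs, sq_abs, div_pow,
        Real.sq_sqrt (tsum_nonneg fun _ => by positivity)]
    simp only [e, tsum_div_const]
    exact div_self_le_one _
  · intro b hb
    by_contra h
    refine hb ?_
    have : b.2 ≠ x + b.1 • s := fun h' => h ⟨b.1, Prod.ext rfl h'.symm⟩
    have h0 : sampleAmp D x s b = 0 := if_neg this
    simp only [h0, norm_zero, zero_pow two_ne_zero]

theorem norm_inputState_le_one {n N ℓ : ℕ} (D : ℤ → ℝ) (x : Fin ℓ → Vect n N) (s : Vect n N) :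
    ‖inputState D x s‖ ≤ 1 := by
  classical
  refine (sq_le_one_iff₀ (norm_nonneg _)).1 ?_
  rw [norm_sq_eq_tsum]
  refine Real.tsum_le_of_sum_le (fun _ => by positivity) fun S => ?_
  calc ∑ h ∈ S, ‖inputState D x s h‖ ^ 2
      = ∑ h ∈ S, ∏ k, ‖sampleAmp D (x k) s (h k)‖ ^ 2 := by
        simp only [inputState, norm_prod, ← prod_pow]
    _ ≤ ∑ h ∈ Fintype.piFinset (fun k => S.image fun h => h k),
          ∏ k, ‖sampleAmp D (x k) s (h k)‖ ^ 2 := by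
        refine sum_le_sum_of_subset_of_nonneg (fun h hh => ?_) fun _ _ _ => by positivity
        exact Fintype.mem_piFinset.2 fun k => mem_image_of_mem _ hh
    _ = ∏ k, ∑ b ∈ S.image (fun h => h k), ‖sampleAmp D (x k) s b‖ ^ 2 :=
        (prod_univ_sum (fun k => S.image fun h => h k)
          fun k b => ‖sampleAmp D (x k) s b‖ ^ 2).symm
    _ ≤ ∏ k : Fin ℓ, (1 : ℝ) :=
        prod_le_prod (fun _ _ => by positivity) fun k _ =>
          ((summable_sampleAmp D (x k) s).sum_le_tsum _ fun _ _ => by positivity).trans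
            (tsum_sampleAmp_le_one D (x k) s)
    _ = 1 := by simp

/-- The basis labels with `a k - e` in the first component and the vector `x k + a k • s`. -/
def pointLabel {n N M ℓ : ℕ} (x : Fin ℓ → Vect n N) (s : Vect n N) (e : ℤ) (a : Fin ℓ → Fin M) :
    Fin ℓ → Label n N :=
  fun k => ((a k : ℤ) - e, x k + (a k : ℤ) • s)

theorem pointLabel_injective {n N M ℓ : ℕ} (x : Fin ℓ → Vect n N) (s : Vect n N) (e : ℤ) :
    Function.Injective (pointLabel (M := M) x s e) := fun a b h => by
  funext k
  have := congrArg Prod.fst (congrFun h k)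
  ext
  simpa [pointLabel] using this

/-- A sample whose weight is supported on `{-e, …, M - 1 - e}` is a finite sum. -/
theorem inputState_eq_sum {n N M ℓ : ℕ} (D : ℤ → ℝ) (e : ℤ)
    (hD : ∀ j, (∀ a : Fin M, (a : ℤ) - e ≠ j) → D j = 0) (x : Fin ℓ → Vect n N) (s : Vect n N) :
    inputState D (fun k => x k + e • s) s = ∑ a : Fin ℓ → Fin M,
      ((∏ k, D ((a k : ℤ) - e) / √(∑' j, D j ^ 2) : ℝ) : ℂ) •
        lp.single 2 (pointLabel x s e a) (1 : ℂ) := by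
  classical
  -- Centring is absorbed by the base point: `(x + e s) + (a - e) s = x + a s`.
  have hrow : ∀ (k : Fin ℓ) (b : Label n N), sampleAmp D (x k + e • s) s b =
      ∑ a : Fin M, if ((a : ℤ) - e, x k + (a : ℤ) • s) = b then
        ((D ((a : ℤ) - e) / √(∑' j, D j ^ 2) : ℝ) : ℂ) else 0 := by
    rintro k ⟨j, y⟩
    by_cases h : ∃ a : Fin M, ((a : ℤ) - e, x k + (a : ℤ) • s) = (j, y)
    · obtain ⟨a, ha⟩ := h
      rw [sum_eq_single a]
      · rw [if_pos ha, sampleAmp, ← ha, if_pos]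
        simp only [add_assoc, ← add_smul]
        congr 2
        ring
      · intro b _ hb
        refine if_neg fun h' => hb ?_
        have := congrArg Prod.fst (h'.trans ha.symm)
        ext
        simpa using this
      · simp
    · push Not at h
      rw [sum_eq_zero fun a _ => if_neg (h a)]
      rw [sampleAmp]
      split_ifs with hy
      · rw [hD j fun a ha => h a (Prod.ext ha ?_)]
        · simp
        · simp only at hy ⊢
          rw [hy, ← ha, add_assoc, ← add_smul]
          congr 2
          ring
      · rfl
  ext h
  have hsum : (∑ a : Fin ℓ → Fin M, ((∏ k, D ((a k : ℤ) - e) / √(∑' j, D j ^ 2) : ℝ) : ℂ) •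
        (lp.single 2 (pointLabel x s e a) (1 : ℂ) : Samples n N ℓ)) h =
      ∑ a : Fin ℓ → Fin M, ((∏ k, D ((a k : ℤ) - e) / √(∑' j, D j ^ 2) : ℝ) : ℂ) *
        if pointLabel x s e a = h then 1 else 0 := by
    rw [lp.coeFn_sum, Finset.sum_apply]
    refine sum_congr rfl fun a _ => ?_
    rw [lp.coeFn_smul, Pi.smul_apply, smul_eq_mul, lp.single_apply, Pi.single_apply]
    simp only [eq_comm]
  rw [hsum]
  simp only [inputState, hrow]
  rw [prod_univ_sum, Fintype.piFinset_univ]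
  refine sum_congr rfl fun a _ => ?_
  by_cases ha : pointLabel x s e a = h
  · rw [if_pos ha, mul_one, Complex.ofReal_prod]
    exact prod_congr rfl fun k _ => if_pos (congrFun ha k)
  · rw [if_neg ha, mul_zero]
    obtain ⟨k, hk⟩ := Function.ne_iff.1 ha
    exact prod_eq_zero (mem_univ k) (if_neg hk)

/-- The basis states over the `M ^ ℓ` label tuples of the support already carry the whole squared
norm. With `norm_inputState_le_one` this makes truncated samples unit vectors. -/
theorem one_le_norm_inputState {n N M ℓ : ℕ} (D : ℤ → ℝ) (e : ℤ)
    (hD : ∀ j, (∀ a : Fin M, (a : ℤ) - e ≠ j) → D j = 0) (h0 : ∑' j, D j ^ 2 ≠ 0)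
    (y : Fin ℓ → Vect n N) (s : Vect n N) : 1 ≤ ‖inputState D y s‖ ^ 2 := by
  classical
  have hinj : Function.Injective fun a : Fin M => (a : ℤ) - e := fun a b h => by
    ext
    simpa using h
  have hS : ∑' j, D j ^ 2 = ∑ a : Fin M, D ((a : ℤ) - e) ^ 2 := by
    rw [← hinj.tsum_eq, tsum_fintype]
    intro j hj
    by_contra h
    exact hj (by simp only [hD j fun a ha => h ⟨a, ha⟩]; norm_num)
  set P : (Fin ℓ → Fin M) → (Fin ℓ → Label n N) :=
    fun a k => ((a k : ℤ) - e, y k + ((a k : ℤ) - e) • s)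
  have hP : Function.Injective P := fun a b h => by
    funext k
    exact hinj (congrArg Prod.fst (congrFun h k))
  calc (1 : ℝ) = ∏ k : Fin ℓ, ∑ a : Fin M, D ((a : ℤ) - e) ^ 2 / ∑' j, D j ^ 2 := by
        rw [← sum_div, ← hS, div_self h0]
        simp
    _ = ∑ a : Fin ℓ → Fin M, ∏ k, D ((a k : ℤ) - e) ^ 2 / ∑' j, D j ^ 2 := by
        rw [prod_univ_sum, Fintype.piFinset_univ]
    _ = ∑ a : Fin ℓ → Fin M, ‖inputState D y s (P a)‖ ^ 2 := by
        refine sum_congr rfl fun a _ => ?_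
        simp only [inputState, norm_prod, ← prod_pow]
        refine prod_congr rfl fun k _ => ?_
        simp only [sampleAmp, P, if_true]
        rw [Complex.norm_real, Real.norm_eq_abs, sq_abs, div_pow,
          Real.sq_sqrt (tsum_nonneg fun _ => by positivity)]
    _ = ∑ h ∈ univ.map ⟨P, hP⟩, ‖inputState D y s h‖ ^ 2 := by simp
    _ ≤ _ := sum_le_norm_sq _ _

/-- The distance between the Gaussian samples and the truncated ones. -/
theorem norm_inputState_sub_sq_le {n N M ℓ : ℕ} {r ε : ℝ} (hr : 0 < r) (hM : r ≤ M)
    (hε : 1 - ε ≤ (∑' j, truncWeight M r j ^ 2) / ∑' j, gaussianWeight r j ^ 2)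
    (y : Fin ℓ → Vect n N) (s : Vect n N) :
    ‖inputState (truncWeight M r) y s - inputState (gaussianWeight r) y s‖ ^ 2 ≤
      2 * (ℓ * ε) := by
  set T := ∑' j, truncWeight M r j ^ 2 with hT
  set S := ∑' j, gaussianWeight r j ^ 2 with hS
  have hSpos : 0 < S := tsum_gaussianWeight_sq_pos hr
  have hTpos : 0 < T := (by positivity : 0 < Real.exp (-(Real.pi / 2)) / 2 * r).trans_le
    (le_tsum_truncWeight_sq hr hM)
  have hTS : T ≤ S := tsum_truncWeight_sq_le hr M
  set g := √T / √S with hg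
  have hgle : g ≤ 1 := div_le_one_of_le₀ (Real.sqrt_le_sqrt hTS) (Real.sqrt_nonneg _)
  have hg0 : 0 ≤ g := by positivity
  have hgsq : g ^ 2 = T / S := by rw [hg, div_pow, Real.sq_sqrt hTpos.le, Real.sq_sqrt hSpos.le]
  -- On the window the normalized Gaussian amplitude is `g = √T/√S` times the truncated one, and
  -- elsewhere the truncated one vanishes. Hence the overlap of the products is `g ^ ℓ`.
  have hrow : ∀ (k : Fin ℓ) (b : Label n N),
      inner ℂ (sampleAmp (truncWeight M r) (y k) s b) (sampleAmp (gaussianWeight r) (y k) s b) =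
        (g : ℂ) * inner ℂ (sampleAmp (truncWeight M r) (y k) s b)
          (sampleAmp (truncWeight M r) (y k) s b) := by
    intro k b
    rw [sampleAmp, sampleAmp]
    split_ifs
    · rw [truncWeight]
      split_ifs
      · simp only [RCLike.inner_apply, Complex.conj_ofReal, ← Complex.ofReal_mul]
        congr 1
        rw [← hT, ← hS, hg]
        have := Real.sqrt_pos.2 hTpos
        have := Real.sqrt_pos.2 hSpos
        field_simp
      · simp
    · simp
  have hinner : inner ℂ (inputState (truncWeight M r) y s) (inputState (gaussianWeight r) y s) =
      (g : ℂ) ^ ℓ * inner ℂ (inputState (truncWeight M r) y s)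
        (inputState (truncWeight M r) y s) := by
    rw [lp.inner_eq_tsum, lp.inner_eq_tsum, ← tsum_mul_left]
    refine tsum_congr fun h => ?_
    have hprod : ∀ f g : Fin ℓ → ℂ, inner ℂ (∏ k, f k) (∏ k, g k) = ∏ k, inner ℂ (f k) (g k) :=
      fun f g => by simp [RCLike.inner_apply, map_prod, prod_mul_distrib]
    simp only [inputState, hprod, hrow, prod_mul_distrib, prod_const, card_univ, Fintype.card_fin]
  have hone : ‖inputState (truncWeight M r) y s‖ ^ 2 = 1 := by
    refine le_antisymm ?_ (one_le_norm_inputState (M := M) _ (M / 2 : ℕ)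
      (fun j hj => truncWeight_eq_zero r hj) hTpos.ne' y s)
    exact (sq_le_one_iff₀ (norm_nonneg _)).2 (norm_inputState_le_one _ _ _)
  have hre : RCLike.re (inner ℂ (inputState (truncWeight M r) y s)
      (inputState (gaussianWeight r) y s)) = g ^ ℓ := by
    rw [hinner, inner_self_eq_norm_sq_to_K, ← Complex.ofReal_pow]
    have : ((‖inputState (truncWeight M r) y s‖ : ℂ)) ^ 2 = 1 := by
      rw [← Complex.ofReal_pow, hone, Complex.ofReal_one]
    erw [this, mul_one]
    exact Complex.ofReal_re _
  have hG := (sq_le_one_iff₀ (norm_nonneg _)).2 (norm_inputState_le_one (gaussianWeight r) y s)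
  -- As `0 ≤ g ≤ 1`, `g ^ ℓ ≥ (g²) ^ ℓ = (T/S) ^ ℓ`, and Bernoulli's inequality applies.
  have hbern : 1 - ℓ * ε ≤ g ^ ℓ := by
    have h1 : 1 + (ℓ : ℝ) * (T / S - 1) ≤ (1 + (T / S - 1)) ^ ℓ :=
      one_add_mul_le_pow (by have : 0 ≤ T / S := by positivity
                             linarith) ℓ
    have h2 : (1 + (T / S - 1)) ^ ℓ ≤ g ^ ℓ := by
      rw [add_sub_cancel, ← hgsq, ← pow_mul, mul_comm, pow_mul]
      exact pow_le_of_le_one (by positivity) (pow_le_one₀ hg0 hgle) two_ne_zero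
    have h3 : (ℓ : ℝ) * (-ε) ≤ ℓ * (T / S - 1) :=
      mul_le_mul_of_nonneg_left (by linarith) (Nat.cast_nonneg _)
    linarith
  rw [@norm_sub_sq ℂ, hre, hone]
  linarith

/-! ### The reduction as a program

Registers: `0, …, 5` hold the inputs `κ, n, N, M, ℓ, ℓ'` (and `5` counts how many rows are still to
be selected), `6` the current row, `7` zero, `8` the column `n + 1` of the ancilla, `9` one,
`10` and `11` the halves of `M`, `12` the centred label, `13` the outcome, `15` minus the half of
`M`, `16` minus one. -/

/-- The angle whose cosine is the Gaussian weight of the centred label. -/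
def gaussianAngle : RExp :=
  .arccos (.exp (.mul (.int (-1)) (.mul .pi
    (.div (.mul (.var 0) (.mul (.var 12) (.var 12))) (.mul (.var 3) (.var 3))))))

/-- Set `v 10` and `v 11` to the upper and the lower half of `v 3`. -/
def halve : Prog :=
  .loop 3 (.ite 11 10 (.set 17 0) (.seq (.add 10 9) (.sub 11 9)))

def setup : Prog :=
  .seq (.set 9 1) (.seq (.set 16 (-1)) (.seq (.add 8 1) (.seq (.add 8 9) (.seq (.add 11 3)
    (.seq halve (.sub 15 11))))))

/-- Angles depend on classical registers only, so all `M` possible labels are tried in turn; on each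
basis state exactly one of the controlled rotations acts. -/
def rotateAll : Prog :=
  .loop 3 (.seq (.rotate ⟨7, 8⟩ ⟨6, 7⟩ 12 gaussianAngle) (.add 12 9))

/-- After the measurement: select the row or reset the ancilla, and go on to the next row. -/
def finishRow : Prog :=
  .seq (.ite 13 7 (.ite 9 5 (.seq (.select 6) (.sub 5 9)) (.set 17 0)) (.qshift ⟨7, 8⟩ 16))
    (.add 6 9)

def processRow : Prog :=
  .seq (.qshift ⟨6, 7⟩ 15) (.seq (.set 12 0) (.seq (.add 12 15) (.seq rotateAll
    (.seq (.measure ⟨7, 8⟩ 13) finishRow))))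

/-- Reject every sample to a Gaussian shape and select the first `ℓ'` samples that succeed. -/
def reduction : Prog := .seq setup (.loop 4 processRow)

/-- The program does not know `r`; the relation `M² = κ r²` replaces it. -/
theorem gaussianAngle_eval {κ M : ℕ} {r : ℝ} (hκ : 0 < κ) (hr : 0 < r) (hM : (M : ℝ) = √κ * r)
    {v : ℕ → ℤ} (h0 : v 0 = κ) (h3 : v 3 = M) :
    gaussianAngle.eval v = Real.arccos (gaussianWeight r (v 12)) := by
  simp only [gaussianAngle, RExp.eval, h0, h3, gaussianWeight]
  congr 2
  push_cast
  have hκ' : (0 : ℝ) < κ := Nat.cast_pos.2 hκ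
  have : (M : ℝ) * M = κ * r ^ 2 := by
    rw [hM, ← sq, mul_pow, Real.sq_sqrt hκ'.le]
  rw [this]
  field_simp

/-- The basis state of the memory for the labels `a`, after the first `k` rows were centred. -/
def rowMem {n N M ℓ : ℕ} (x : Fin ℓ → Vect n N) (s : Vect n N) (k : ℕ) (a : Fin ℓ → Fin M) : Mem :=
  fun p => load (pointLabel x s 0 a) p - if p.2 = 0 ∧ p.1 < k then ((M / 2 : ℕ) : ℤ) else 0

/-- The product state with real weights `W`. -/
noncomputable def productKet {n N M ℓ : ℕ} (x : Fin ℓ → Vect n N) (s : Vect n N) (k : ℕ)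
    (W : Fin ℓ → Fin M → ℝ) : Mem →₀ ℂ :=
  ∑ a : Fin ℓ → Fin M, ((∏ i, W i (a i) : ℝ) : ℂ) • Finsupp.single (rowMem x s k a) 1

/-- The squared norm of the product state with weights `W`. -/
def weightSq {M ℓ : ℕ} (W : Fin ℓ → Fin M → ℝ) : ℝ := ∏ i, ∑ j, W i j ^ 2

section rowMem

variable {n N M ℓ : ℕ} (x : Fin ℓ → Vect n N) (s : Vect n N)

theorem rowMem_zero (a : Fin ℓ → Fin M) : rowMem x s 0 a = load (pointLabel x s 0 a) := by
  funext p
  simp [rowMem]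

theorem rowMem_shift (k : ℕ) (a : Fin ℓ → Fin M) :
    (rowMem x s k a).shift (k, 0) (-((M / 2 : ℕ) : ℤ)) = rowMem x s (k + 1) a := by
  funext p
  by_cases hp : p = (k, 0)
  · subst hp
    simp [Mem.shift, rowMem, sub_eq_add_neg]
  · rw [Mem.shift, Function.update_of_ne hp, rowMem, rowMem]
    have : (p.2 = 0 ∧ p.1 < k) ↔ (p.2 = 0 ∧ p.1 < k + 1) := by
      constructor
      · rintro ⟨h, h'⟩
        exact ⟨h, by lia⟩
      · rintro ⟨h, h'⟩
        refine ⟨h, lt_of_le_of_ne (by lia) fun h'' => hp (Prod.ext h'' h)⟩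
    simp only [this]

theorem rowMem_ancilla (k : ℕ) (a : Fin ℓ → Fin M) : rowMem x s k a (0, n + 1) = 0 := by
  simp [rowMem, load]

theorem rowMem_label {k : ℕ} (hk : k < ℓ) (a : Fin ℓ → Fin M) :
    rowMem x s (k + 1) a (k, 0) = (a ⟨k, hk⟩ : ℤ) - (M / 2 : ℕ) := by
  simp [rowMem, load, hk, pointLabel]

/-- The label columns alone determine `a`, so the terms of `productKet` are distinct basis states.
-/
theorem rowMem_injective (k : ℕ) : Function.Injective (rowMem (M := M) x s k) := by
  intro a b h
  funext i
  have := congrFun h ((i : ℕ), 0)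
  simp only [rowMem, load, i.2, pointLabel, sub_zero, dite_true, if_true, sub_left_inj,
    Fin.eta] at this
  ext
  exact_mod_cast this

/-- Needed for measurement outcomes that do not occur: they produce no branch, and this shows that
their weight is zero, so the probability count stays complete. -/
theorem weightSq_eq_zero {k : ℕ} {W : Fin ℓ → Fin M → ℝ} (h : productKet x s k W = 0) :
    weightSq W = 0 := by
  classical
  have hz : ∀ a : Fin ℓ → Fin M, ∏ i, W i (a i) = 0 := fun a => by
    have := DFunLike.congr_fun h (rowMem x s k a)
    rw [productKet, Finsupp.finsetSum_apply, sum_eq_single a] at this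
    · rw [Finsupp.smul_apply, Finsupp.single_eq_same, smul_eq_mul, mul_one] at this
      exact Complex.ofReal_eq_zero.1 this
    · intro b _ hb
      rw [Finsupp.smul_apply, Finsupp.single_eq_of_ne, smul_zero]
      exact fun h' => hb (rowMem_injective x s k h'.symm)
    · simp
  rw [weightSq, prod_univ_sum]
  refine sum_eq_zero fun a _ => ?_
  rw [prod_pow, hz a, zero_pow two_ne_zero]

end rowMem

theorem prod_update_mul {M ℓ : ℕ} (W : Fin ℓ → Fin M → ℝ) (k : Fin ℓ) (g : Fin M → ℝ)
    (a : Fin ℓ → Fin M) :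
    ∏ i, Function.update W k (fun j => W k j * g j) i (a i) = (∏ i, W i (a i)) * g (a k) := by
  rw [← mul_prod_erase _ _ (mem_univ k), ← mul_prod_erase _ (fun i => W i (a i)) (mem_univ k),
    Function.update_self, mul_right_comm]
  refine congrArg (W k (a k) * · * g (a k)) (prod_congr rfl fun i hi => ?_)
  rw [Function.update_of_ne (ne_of_mem_erase hi)]

theorem weightSq_update {M ℓ : ℕ} (W : Fin ℓ → Fin M → ℝ) (k : Fin ℓ) (w : Fin M → ℝ) {p : ℝ}
    (hk : ∑ j, W k j ^ 2 = 1) (hw : ∑ j, w j ^ 2 = p) :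
    weightSq (Function.update W k w) = p * weightSq W := by
  rw [weightSq, weightSq, ← mul_prod_erase _ _ (mem_univ k),
    ← mul_prod_erase _ (fun i => ∑ j, W i j ^ 2) (mem_univ k), Function.update_self, hw, hk, one_mul]
  congr 1
  exact prod_congr rfl fun i hi => by rw [Function.update_of_ne (ne_of_mem_erase hi)]

/-! ### The controlled rotations of one row -/

theorem exec_rotate {R S : QRef} {a : ℕ} {θ : RExp} {σ : State} {A B : ℕ × ℕ}
    {z : ℤ} {t : ℝ} (hne : A ≠ B) (hR : R.addr σ.v = A) (hS : S.addr σ.v = B) (hz : σ.v a = z)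
    (ht : θ.eval σ.v = t) :
    exec (.rotate R S a θ) σ = {{ σ.tick with
      amp := Finsupp.linearCombination ℂ (fun m =>
        if m B = z then rotateBasis A t m else Finsupp.single m 1) σ.amp }} := by
  subst hR hS hz ht
  rw [exec, if_neg hne]

/-- The rotation loop writes the Gaussian weights of the label of row `k` into the ancilla. -/
theorem exec_rotateAll {κ n N M ℓ : ℕ} {r : ℝ} (hκ : 0 < κ) (hr : 0 < r) (hM : (M : ℝ) = √κ * r)
    (x : Fin ℓ → Vect n N) (s : Vect n N) {k : ℕ} (hk : k < ℓ) (c : (Fin ℓ → Fin M) → ℂ) (σ : State)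
    (h0 : σ.v 0 = κ) (h3 : σ.v 3 = M) (h6 : σ.v 6 = k) (h7 : σ.v 7 = 0) (h8 : σ.v 8 = n + 1)
    (h9 : σ.v 9 = 1) (h12 : σ.v 12 = -((M / 2 : ℕ) : ℤ))
    (hamp : σ.amp = ∑ a, c a • Finsupp.single (rowMem x s (k + 1) a) 1) :
    exec rotateAll σ = {{
      v := Function.update σ.v 12 (-((M / 2 : ℕ) : ℤ) + M)
      sel := σ.sel
      amp := ∑ a, c a • rotateBasis (0, n + 1)
        (Real.arccos (gaussianWeight r ((a ⟨k, hk⟩ : ℤ) - (M / 2 : ℕ)))) (rowMem x s (k + 1) a)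
      time := σ.time + 1 + 3 * M }} := by
  -- Invariant: after `t` rounds exactly the basis states with uncentred label below `t` have been
  -- rotated.
  have key : ∀ t : ℕ, t ≤ M → (fun B : Multiset State => B.bind fun τ =>
      exec (.seq (.rotate ⟨7, 8⟩ ⟨6, 7⟩ 12 gaussianAngle) (.add 12 9)) τ.tick)^[t] {σ.tick} = {{
      v := Function.update σ.v 12 (-((M / 2 : ℕ) : ℤ) + t)
      sel := σ.sel
      amp := ∑ a, c a • if (a ⟨k, hk⟩ : ℕ) < t then rotateBasis (0, n + 1)
        (Real.arccos (gaussianWeight r ((a ⟨k, hk⟩ : ℤ) - (M / 2 : ℕ)))) (rowMem x s (k + 1) a)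
        else Finsupp.single (rowMem x s (k + 1) a) 1
      time := σ.time + 1 + 3 * t }} := by
    intro t
    induction t with
    | zero =>
      intro _
      rw [Nat.cast_zero, add_zero, ← h12, Function.update_eq_self]
      simp [State.tick, hamp]
    | succ t ih =>
      intro ht
      rw [Function.iterate_succ_apply', ih (by lia)]
      have hne : ((0 : ℕ), n + 1) ≠ (k, 0) := by simp
      have e : Function.update σ.v 12 (-((M / 2 : ℕ) : ℤ) + t) 12 = -((M / 2 : ℕ) : ℤ) + t :=
        Function.update_self ..
      rw [Multiset.singleton_bind, exec, exec_rotate (A := (0, n + 1)) (B := (k, 0))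
        (z := -((M / 2 : ℕ) : ℤ) + t)
        (t := Real.arccos (gaussianWeight r (-((M / 2 : ℕ) : ℤ) + t))) hne, Multiset.singleton_bind,
        exec]
      rotate_left
      · simp [State.tick, QRef.addr, h7, h8]
      · simp [State.tick, QRef.addr, h6, h7]
      · exact e
      · rw [gaussianAngle_eval hκ hr hM (by simpa [State.tick] using h0)
          (by simpa [State.tick] using h3)]
        simp only [State.tick, e]
      simp only [State.tick]
      congr 2
      · funext i
        by_cases hi : i = 12
        · subst hi
          simp [h9]
          ring
        · simp [hi]
      · rw [map_sum]
        refine sum_congr rfl fun a _ => ?_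
        rw [map_smul]
        congr 1
        have hlab := rowMem_label x s hk a
        have hanc := rowMem_ancilla x s (k + 1) a
        have hlab' : Function.update (rowMem x s (k + 1) a) (0, n + 1) 1 (k, 0) =
            (a ⟨k, hk⟩ : ℤ) - (M / 2 : ℕ) := by
          rw [Function.update_of_ne hne.symm, hlab]
        -- Rotating the ancilla leaves the label intact, so both branches of an already rotated
        -- state fail the control test of this round.
        rcases lt_trichotomy (a ⟨k, hk⟩ : ℕ) t with h | h | h
        · have hne' : (a ⟨k, hk⟩ : ℤ) - (M / 2 : ℕ) ≠ -((M / 2 : ℕ) : ℤ) + t := by omega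
          rw [if_pos h, if_pos (by omega), rotateBasis, if_pos hanc, map_add,
            Finsupp.linearCombination_single, Finsupp.linearCombination_single, hlab, hlab',
            if_neg hne', if_neg hne', Finsupp.smul_single_one, Finsupp.smul_single_one]
        · have heq : (a ⟨k, hk⟩ : ℤ) - (M / 2 : ℕ) = -((M / 2 : ℕ) : ℤ) + t := by omega
          rw [if_neg (by omega), if_pos (by omega), Finsupp.linearCombination_single, hlab,
            if_pos heq, one_smul, heq]
        · have hne' : (a ⟨k, hk⟩ : ℤ) - (M / 2 : ℕ) ≠ -((M / 2 : ℕ) : ℤ) + t := by omega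
          rw [if_neg (by omega), if_neg (by omega), Finsupp.linearCombination_single, hlab,
            if_neg hne', one_smul]
  have := key M le_rfl
  simp only [(Fin.is_lt _), if_true] at this
  rw [rotateAll, exec, h3, Int.toNat_natCast, this]

/-! ### Processing one row -/

/-- The amplitude that the rotation of label `j` gives to the outcome `z` of the ancilla. -/
noncomputable def outcomeFactor {M : ℕ} (r : ℝ) (z : ℤ) (j : Fin M) : ℝ :=
  if z = 0 then Real.cos (Real.arccos (gaussianWeight r ((j : ℤ) - (M / 2 : ℕ))))
  else Real.sin (Real.arccos (gaussianWeight r ((j : ℤ) - (M / 2 : ℕ))))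

theorem outcomeFactor_zero {M : ℕ} (r : ℝ) (j : Fin M) :
    outcomeFactor r 0 j = gaussianWeight r ((j : ℤ) - (M / 2 : ℕ)) := by
  rw [outcomeFactor, if_pos rfl, Real.cos_arccos _ (gaussianWeight_le_one _ _)]
  linarith [gaussianWeight_pos r ((j : ℤ) - (M / 2 : ℕ))]

theorem outcomeFactor_sq_add {M : ℕ} (r : ℝ) (j : Fin M) :
    outcomeFactor r 0 j ^ 2 + outcomeFactor r 1 j ^ 2 = 1 := by
  simp [outcomeFactor]

/-- The weights after the outcome `z` in row `k`. -/
noncomputable def updateWeight {M ℓ : ℕ} (r : ℝ) (W : Fin ℓ → Fin M → ℝ) (k : Fin ℓ) (z : ℤ) :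
    Fin ℓ → Fin M → ℝ :=
  Function.update W k fun j => W k j * outcomeFactor r z j

/-- The state `σ` of the machine after `k` rows, when `t` rows are still to be selected. -/
structure Progress (κ : ℕ) {n N M ℓ : ℕ} (r : ℝ) (x : Fin ℓ → Vect n N) (s : Vect n N)
    (ℓ' k t T : ℕ) (W : Fin ℓ → Fin M → ℝ) (σ : State) : Prop where
  v0 : σ.v 0 = κ
  v3 : σ.v 3 = M
  v5 : σ.v 5 = t
  v6 : σ.v 6 = k
  v7 : σ.v 7 = 0
  v8 : σ.v 8 = n + 1
  v9 : σ.v 9 = 1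
  v15 : σ.v 15 = -((M / 2 : ℕ) : ℤ)
  v16 : σ.v 16 = -1
  amp : σ.amp = productKet x s k W
  nodup : σ.sel.Nodup
  length : σ.sel.length + t = ℓ'
  -- Rows that were processed but not selected are left unconstrained; they only contribute to the
  -- weight of the branch.
  selected : ∀ i ∈ σ.sel, ∃ h : i < ℓ, i < k ∧
    ∀ j, W ⟨i, h⟩ j = 1 / √M * gaussianWeight r ((j : ℤ) - (M / 2 : ℕ))
  rest : ∀ i : Fin ℓ, k ≤ i → ∀ j, W i j = 1 / √M
  time : σ.time ≤ T

theorem exec_finishRow_select {σ : State} {k t : ℕ} (h5 : σ.v 5 = t + 1) (h6 : σ.v 6 = k)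
    (h7 : σ.v 7 = 0) (h9 : σ.v 9 = 1) (h13 : σ.v 13 = 0) :
    exec finishRow σ = {{
      v := Function.update (Function.update σ.v 5 t) 6 (k + 1)
      sel := σ.sel ++ [k]
      amp := σ.amp
      time := σ.time + 5 }} := by
  simp [finishRow, exec, State.tick, h5, h6, h7, h9, h13]

theorem exec_finishRow_skip {σ : State} {k : ℕ} (h5 : σ.v 5 = 0) (h6 : σ.v 6 = k)
    (h7 : σ.v 7 = 0) (h9 : σ.v 9 = 1) (h13 : σ.v 13 = 0) :
    exec finishRow σ = {{
      v := Function.update (Function.update σ.v 17 0) 6 (k + 1)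
      sel := σ.sel
      amp := σ.amp
      time := σ.time + 4 }} := by
  simp [finishRow, exec, State.tick, h5, h6, h7, h9, h13]

/-- After outcome `1` the ancilla holds `1`; subtracting `1` makes it reusable for the next row.
After outcome `0` it is already clean. -/
theorem exec_finishRow_reset {σ : State} {k n : ℕ} (h6 : σ.v 6 = k) (h7 : σ.v 7 = 0)
    (h8 : σ.v 8 = n + 1) (h9 : σ.v 9 = 1) (h13 : σ.v 13 = 1) (h16 : σ.v 16 = -1) :
    exec finishRow σ = {{
      v := Function.update σ.v 6 (k + 1)
      sel := σ.sel
      amp := σ.amp.mapDomain fun m => m.shift (0, n + 1) (-1)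
      time := σ.time + 3 }} := by
  have : QRef.addr σ.v ⟨7, 8⟩ = (0, n + 1) := by simp [QRef.addr, h7, h8]
  simp [finishRow, exec, State.tick, h6, h7, h9, h13, h16, this]

theorem filter_rotateBasis (A : ℕ × ℕ) (t : ℝ) (m : Mem) (hm : m A = 0) (z : ℤ) :
    (rotateBasis A t m).filter (fun m => m A = z) =
      if z = 0 then Finsupp.single m (Real.cos t : ℂ)
      else if z = 1 then Finsupp.single (Function.update m A 1) (Real.sin t : ℂ) else 0 := by
  rw [rotateBasis, if_pos hm, Finsupp.filter_add]
  split_ifs with h0 h1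
  · subst h0
    rw [Finsupp.filter_single_of_pos (fun m : Mem => m A = 0) hm, Finsupp.filter_single_of_neg, add_zero]
    simp
  · subst h1
    rw [Finsupp.filter_single_of_neg, Finsupp.filter_single_of_pos, zero_add]
    · simp
    · simp [hm]
  · rw [Finsupp.filter_single_of_neg, Finsupp.filter_single_of_neg, zero_add]
    · simpa [eq_comm] using h1
    · simpa [hm, eq_comm] using h0

theorem Mem.shift_update_one (m : Mem) (A : ℕ × ℕ) (hm : m A = 0) :
    Mem.shift (Function.update m A 1) A (-1) = m := by
  rw [Mem.shift, Function.update_self, Function.update_idem, add_neg_cancel, ← hm,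
    Function.update_eq_self]

theorem filter_eq_zero_iff {A : ℕ × ℕ} (ψ : Mem →₀ ℂ) (z : ℤ) :
    ψ.filter (fun m => m A = z) = 0 ↔ z ∉ ψ.support.image fun m => m A := by
  rw [Finsupp.filter_eq_zero_iff]
  simp only [mem_image, Finsupp.mem_support_iff, not_exists, not_and]
  exact ⟨fun h m hm hz => hm (h m hz), fun h m hz => by_contra fun hm => h m hm hz⟩

section processRow

variable {κ n N M ℓ : ℕ} {r : ℝ} {x : Fin ℓ → Vect n N} {s : Vect n N} {ℓ' k t T : ℕ}
  {W : Fin ℓ → Fin M → ℝ} {σ : State}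

/-- The state after the rotations of row `k`. -/
noncomputable def rotatedKet (r : ℝ) (x : Fin ℓ → Vect n N) (s : Vect n N) (W : Fin ℓ → Fin M → ℝ)
    (k : Fin ℓ) : Mem →₀ ℂ :=
  ∑ a, ((∏ i, W i (a i) : ℝ) : ℂ) • rotateBasis (0, n + 1)
    (Real.arccos (gaussianWeight r ((a k : ℤ) - (M / 2 : ℕ)))) (rowMem x s (k + 1) a)

theorem filter_rotatedKet_zero (k : Fin ℓ) :
    (rotatedKet r x s W k).filter (fun m => m (0, n + 1) = 0) =
      productKet x s (k + 1) (updateWeight r W k 0) := by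
  rw [rotatedKet, Finsupp.filter_sum, productKet]
  refine sum_congr rfl fun a _ => ?_
  rw [Finsupp.filter_smul, filter_rotateBasis _ _ _ (rowMem_ancilla ..), if_pos rfl, updateWeight,
    prod_update_mul, outcomeFactor, if_pos rfl]
  simp

theorem mapDomain_filter_rotatedKet_one (k : Fin ℓ) :
    ((rotatedKet r x s W k).filter (fun m => m (0, n + 1) = 1)).mapDomain
        (fun m => m.shift (0, n + 1) (-1)) =
      productKet x s (k + 1) (updateWeight r W k 1) := by
  rw [rotatedKet, Finsupp.filter_sum, productKet, Finsupp.mapDomain_finsetSum]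
  refine sum_congr rfl fun a _ => ?_
  rw [Finsupp.filter_smul, filter_rotateBasis _ _ _ (rowMem_ancilla ..), if_neg one_ne_zero,
    if_pos rfl, updateWeight, prod_update_mul, outcomeFactor, if_neg one_ne_zero,
    Finsupp.mapDomain_smul, Finsupp.mapDomain_single, Mem.shift_update_one _ _ (rowMem_ancilla ..)]
  simp

theorem filter_rotatedKet_of_ne (k : Fin ℓ) {z : ℤ} (h0 : z ≠ 0) (h1 : z ≠ 1) :
    (rotatedKet r x s W k).filter (fun m => m (0, n + 1) = z) = 0 := by
  rw [rotatedKet, Finsupp.filter_sum]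
  refine sum_eq_zero fun a _ => ?_
  rw [Finsupp.filter_smul, filter_rotateBasis _ _ _ (rowMem_ancilla ..), if_neg h0, if_neg h1,
    smul_zero]

theorem exec_rotate_row (hκ : 0 < κ) (hr : 0 < r) (hM : (M : ℝ) = √κ * r)
    (h : Progress κ r x s ℓ' k t T W σ) (hk : k < ℓ) (P : Prog) :
    exec (.seq (.qshift ⟨6, 7⟩ 15) (.seq (.set 12 0) (.seq (.add 12 15) (.seq rotateAll P)))) σ =
      exec P {
      v := Function.update σ.v 12 (-((M / 2 : ℕ) : ℤ) + M)
      sel := σ.sel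
      amp := rotatedKet r x s W ⟨k, hk⟩
      time := σ.time + 3 * M + 4 } := by
  have haddr : QRef.addr σ.v ⟨6, 7⟩ = (k, 0) := by simp [QRef.addr, h.v6, h.v7]
  have hshift : σ.amp.mapDomain (fun m => m.shift (k, 0) (-((M / 2 : ℕ) : ℤ))) =
      ∑ a, ((∏ i, W i (a i) : ℝ) : ℂ) • Finsupp.single (rowMem x s (k + 1) a) 1 := by
    rw [h.amp, productKet, Finsupp.mapDomain_finsetSum]
    refine sum_congr rfl fun a _ => ?_
    rw [Finsupp.mapDomain_smul, Finsupp.mapDomain_single, rowMem_shift]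
  rw [exec, exec, haddr, h.v15, hshift, Multiset.singleton_bind, exec, exec,
    Multiset.singleton_bind, exec, exec, Multiset.singleton_bind, exec,
    exec_rotateAll hκ hr hM x s hk fun a => ((∏ i, W i (a i) : ℝ) : ℂ), Multiset.singleton_bind]
  · congr 1
    simp only [State.tick, rotatedKet, Function.update_idem]
    congr 1
    ring
  all_goals simp [State.tick, h.v0, h.v3, h.v6, h.v7, h.v8, h.v9, h.v15]

theorem Progress.updateWeight_selected (h : Progress κ r x s ℓ' k t T W σ) (hk : k < ℓ) (z : ℤ) :
    ∀ i ∈ σ.sel, ∃ h : i < ℓ, i < k + 1 ∧ ∀ j, updateWeight r W ⟨k, hk⟩ z ⟨i, h⟩ j =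
      1 / √M * gaussianWeight r ((j : ℤ) - (M / 2 : ℕ)) := by
  intro i hi
  obtain ⟨hl, hik, hW⟩ := h.selected i hi
  refine ⟨hl, by lia, fun j => ?_⟩
  rw [updateWeight, Function.update_of_ne, hW]
  simp only [ne_eq, Fin.mk.injEq]
  lia

theorem Progress.updateWeight_rest (h : Progress κ r x s ℓ' k t T W σ) (hk : k < ℓ) (z : ℤ) :
    ∀ i : Fin ℓ, k + 1 ≤ i → ∀ j, updateWeight r W ⟨k, hk⟩ z i j = 1 / √M := by
  intro i hi j
  rw [updateWeight, Function.update_of_ne, h.rest i (by lia)]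
  rintro rfl
  simp at hi

/-- Processing a row: outcome `0` shapes the sample and selects it if samples are still needed. -/
theorem exec_processRow (hκ : 0 < κ) (hr : 0 < r) (hM : (M : ℝ) = √κ * r)
    (h : Progress κ r x s ℓ' k t T W σ) (hk : k < ℓ) :
    ∃ (Z : Finset ℤ) (τ : ℤ → State), exec processRow σ = Z.val.map τ ∧ Z ⊆ {0, 1} ∧
      (∀ z ∈ Z, Progress κ r x s ℓ' (k + 1) (if z = 0 then t - 1 else t) (T + 3 * M + 10)
        (updateWeight r W ⟨k, hk⟩ z) (τ z)) ∧
      ∀ z ∈ ({0, 1} : Finset ℤ), z ∉ Z → weightSq (updateWeight r W ⟨k, hk⟩ z) = 0 := by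
  set ψ := rotatedKet r x s W ⟨k, hk⟩ with hψ
  set Z : Finset ℤ := ψ.support.image fun m => m (0, n + 1) with hZ
  set ρ : ℤ → State := fun z => {
    v := Function.update (Function.update σ.v 12 (-((M / 2 : ℕ) : ℤ) + M)) 13 z
    sel := σ.sel
    amp := ψ.filter fun m => m (0, n + 1) = z
    time := σ.time + 3 * M + 5 } with hρ
  have hexec : exec processRow σ = (Z.val.map ρ).bind (exec finishRow) := by
    have haddr : QRef.addr (Function.update σ.v 12 (-((M / 2 : ℕ) : ℤ) + M)) ⟨7, 8⟩ =
        (0, n + 1) := by simp [QRef.addr, h.v7, h.v8]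
    rw [processRow, exec_rotate_row hκ hr hM h hk, exec, exec]
    simp only [haddr, State.tick]
    rfl
  have hsub : Z ⊆ {0, 1} := fun z hz => by
    by_contra hne
    simp only [mem_insert, mem_singleton, not_or] at hne
    exact (filter_eq_zero_iff ψ z).1 (filter_rotatedKet_of_ne _ hne.1 hne.2) hz
  have hstep : ∀ z ∈ Z, ∃ τ, exec finishRow (ρ z) = {τ} ∧
      Progress κ r x s ℓ' (k + 1) (if z = 0 then t - 1 else t) (T + 3 * M + 10)
        (updateWeight r W ⟨k, hk⟩ z) τ := by
    intro z hz
    have htime := h.time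
    obtain rfl | rfl : z = 0 ∨ z = 1 := by simpa using hsub hz
    -- With `t = 0` an accepted row is no longer needed and is skipped, which agrees with `t - 1 =
    -- 0` in natural subtraction.
    · rcases t with _ | t
      · refine ⟨_, exec_finishRow_skip (k := k) ?_ ?_ ?_ ?_ ?_, ?_⟩
        · simpa [hρ] using h.v5
        · simpa [hρ] using h.v6
        · simpa [hρ] using h.v7
        · simpa [hρ] using h.v9
        · simp [hρ]
        · constructor
          case amp => exact filter_rotatedKet_zero _
          case nodup => exact h.nodup
          case length => exact h.length
          case selected => exact h.updateWeight_selected hk 0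
          case rest => exact h.updateWeight_rest hk 0
          case time => simp only [hρ]; lia
          all_goals simp [hρ, h.v0, h.v3, h.v5, h.v7, h.v8, h.v9, h.v15, h.v16]
      · refine ⟨_, exec_finishRow_select (k := k) (t := t) ?_ ?_ ?_ ?_ ?_, ?_⟩
        · simpa [hρ] using h.v5
        · simpa [hρ] using h.v6
        · simpa [hρ] using h.v7
        · simpa [hρ] using h.v9
        · simp [hρ]
        · constructor
          case amp => exact filter_rotatedKet_zero _
          case nodup =>
            refine h.nodup.append (List.nodup_singleton k) ?_
            rw [List.disjoint_singleton]
            -- All previously selected rows have index below `k`.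
            intro hmem
            obtain ⟨_, hlt, _⟩ := h.selected k hmem
            exact lt_irrefl k hlt
          case length =>
            have := h.length
            simp [hρ]
            lia
          case selected =>
            intro i hi
            rcases List.mem_append.1 hi with hi | hi
            · exact h.updateWeight_selected hk 0 i hi
            · obtain rfl := List.mem_singleton.1 hi
              refine ⟨hk, by lia, fun j => ?_⟩
              rw [updateWeight, Function.update_self, h.rest ⟨i, hk⟩ le_rfl, outcomeFactor_zero]
          case rest => exact h.updateWeight_rest hk 0
          case time => simp only [hρ]; lia
          all_goals simp [hρ, h.v0, h.v3, h.v7, h.v8, h.v9, h.v15, h.v16]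
    · refine ⟨_, exec_finishRow_reset (k := k) (n := n) ?_ ?_ ?_ ?_ ?_ ?_, ?_⟩
      · simpa [hρ] using h.v6
      · simpa [hρ] using h.v7
      · simpa [hρ] using h.v8
      · simpa [hρ] using h.v9
      · simp [hρ]
      · simpa [hρ] using h.v16
      · constructor
        case amp => exact mapDomain_filter_rotatedKet_one _
        case nodup => exact h.nodup
        case length => exact h.length
        case selected => exact h.updateWeight_selected hk 1
        case rest => exact h.updateWeight_rest hk 1
        case time => simp only [hρ]; lia
        all_goals simp [hρ, h.v0, h.v3, h.v5, h.v7, h.v8, h.v9, h.v15, h.v16]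
  have : Nonempty State := ⟨σ⟩
  choose! τ hτ hprog using hstep
  refine ⟨Z, τ, ?_, hsub, hprog, fun z hz hzZ => ?_⟩
  · rw [hexec, Multiset.bind_map, Multiset.bind_congr fun z hz => hτ z hz,
      Multiset.bind_singleton]
  · have h0 := (filter_eq_zero_iff ψ z).2 hzZ
    obtain rfl | rfl : z = 0 ∨ z = 1 := by simpa using hz
    · rw [hψ, filter_rotatedKet_zero] at h0
      exact weightSq_eq_zero x s h0
    · have h1 := mapDomain_filter_rotatedKet_one (r := r) (x := x) (s := s) (W := W) ⟨k, hk⟩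
      rw [← hψ, h0, Finsupp.mapDomain_zero] at h1
      exact weightSq_eq_zero x s h1.symm

end processRow

/-! ### The answer on the selected rows -/

theorem answerProb_nonneg {n N ℓ : ℕ} (Q : Solver n N ℓ) (s : Vect n N) (σ : State) :
    0 ≤ answerProb Q s σ := by
  rw [answerProb]
  split_ifs
  · exact sum_nonneg fun _ _ => Q.prob_nonneg s _
  · rfl

open Classical in
-- Linearity in `ψ` allows computing components from any expansion, without knowing the support.
theorem component_eq_linearCombination {ℓ : ℕ} (n N : ℕ) (R : Fin ℓ → ℕ) (ψ : Mem →₀ ℂ) (g : Mem) :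
    component n N R ψ g = Finsupp.linearCombination ℂ (fun m =>
      if eraseRows n R m = g ∧ HoldsLabels n N R m then
        (lp.single 2 (labels n N R m) (1 : ℂ) : Samples n N ℓ) else 0) ψ := by
  rw [component, Finsupp.linearCombination_apply, Finsupp.sum, sum_filter]
  exact sum_congr rfl fun m _ => by split_ifs <;> simp

open Classical in
/-- If the memory is a product of a state of the rows `R` and a state of the rest, then the solver
sees the former. -/
theorem sum_prob_component_ge {n N ℓ : ℕ} {α β : Type*} [Fintype α] [Fintype β] (Q : Solver n N ℓ)
    (s : Vect n N) (R : Fin ℓ → ℕ) (u : α → ℂ) (w : β → ℂ) (m : α → β → Mem) (F : β → Mem)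
    (L : α → Fin ℓ → Label n N) (hF : F.Injective) (hm : ∀ a b, eraseRows n R (m a b) = F b)
    (hh : ∀ a b, HoldsLabels n N R (m a b)) (hL : ∀ a b, labels n N R (m a b) = L a)
    (ψ : Mem →₀ ℂ) (hψ : ψ = ∑ a, ∑ b, (u a * w b) • Finsupp.single (m a b) 1) :
    (∑ b, ‖w b‖ ^ 2) * Q.prob s (∑ a, u a • lp.single 2 (L a) (1 : ℂ)) ≤
      ∑ g ∈ ψ.support.image (eraseRows n R), Q.prob s (component n N R ψ g) := by
  have hcomp : ∀ b, component n N R ψ (F b) = w b • ∑ a, u a • lp.single 2 (L a) (1 : ℂ) := by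
    intro b
    rw [component_eq_linearCombination, hψ, map_sum, smul_sum]
    refine sum_congr rfl fun a _ => ?_
    rw [map_sum, sum_eq_single b]
    · rw [map_smul, Finsupp.linearCombination_single, if_pos ⟨hm a b, hh a b⟩, hL, one_smul,
        smul_smul, mul_comm]
    · intro b' _ hb
      rw [map_smul, Finsupp.linearCombination_single, if_neg, smul_zero, smul_zero]
      rintro ⟨h, -⟩
      exact hb (hF ((hm a b').symm.trans h))
    · simp
  -- `F b` may be missing from the support image when its component vanishes; such terms contribute
  -- nothing.
  have hzero : ∀ g, Q.prob s (component n N R ψ g) ≠ 0 → g ∈ ψ.support.image (eraseRows n R) := by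
    intro g hg
    by_contra hmem
    refine hg ?_
    have : component n N R ψ g = 0 := by
      rw [component]
      refine sum_eq_zero fun m hm => absurd (mem_image.2 ⟨m, ?_, ?_⟩) hmem
      · exact (mem_filter.1 hm).1
      · exact (mem_filter.1 hm).2.1
    rw [this, ← zero_smul ℂ (0 : Samples n N ℓ), Q.prob_smul]
    simp
  calc (∑ b, ‖w b‖ ^ 2) * Q.prob s (∑ a, u a • lp.single 2 (L a) (1 : ℂ))
      = ∑ b, Q.prob s (component n N R ψ (F b)) := by
        rw [sum_mul]
        exact sum_congr rfl fun b _ => by rw [hcomp, Q.prob_smul]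
    _ = ∑ g ∈ univ.map ⟨F, hF⟩, Q.prob s (component n N R ψ g) := by simp
    _ = ∑ g ∈ univ.map ⟨F, hF⟩ with Q.prob s (component n N R ψ g) ≠ 0,
          Q.prob s (component n N R ψ g) := (sum_filter_ne_zero _).symm
    _ ≤ _ := sum_le_sum_of_subset_of_nonneg (fun g hg => hzero g (mem_filter.1 hg).2)
        fun _ _ _ => Q.prob_nonneg s _

/-- The labels of all rows are those of the rows `R k` and those of the other rows. -/
noncomputable def splitRows {ℓ ℓ' : ℕ} (M : ℕ) (R : Fin ℓ' → Fin ℓ) (hR : R.Injective) :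
    (Fin ℓ → Fin M) ≃ (Fin ℓ' → Fin M) × ({i // i ∉ Set.range R} → Fin M) :=
  open Classical in
  (Equiv.piEquivPiSubtypeProd (· ∈ Set.range R) fun _ => Fin M).trans
    (Equiv.prodCongr ((Equiv.ofInjective R hR).arrowCongr (Equiv.refl _)).symm (Equiv.refl _))

section splitRows

variable {ℓ ℓ' M : ℕ} {R : Fin ℓ' → Fin ℓ} (hR : R.Injective)

theorem splitRows_fst (a : Fin ℓ → Fin M) (k : Fin ℓ') : (splitRows M R hR a).1 k = a (R k) := rfl

theorem splitRows_snd (a : Fin ℓ → Fin M) (i : {i // i ∉ Set.range R}) :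
    (splitRows M R hR a).2 i = a i := rfl

theorem splitRows_symm_range (p) (k : Fin ℓ') : (splitRows M R hR).symm p (R k) = p.1 k := by
  rw [← splitRows_fst hR ((splitRows M R hR).symm p) k, Equiv.apply_symm_apply]

theorem splitRows_symm_compl (p) (i : {i // i ∉ Set.range R}) :
    (splitRows M R hR).symm p i = p.2 i := by
  rw [← splitRows_snd hR ((splitRows M R hR).symm p) i, Equiv.apply_symm_apply]

open Classical in
theorem prod_range_mul_prod_compl (hR : R.Injective) (f : Fin ℓ → ℝ) :
    (∏ k, f (R k)) * ∏ i : {i // i ∉ Set.range R}, f i = ∏ i, f i := by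
  rw [← Fintype.prod_subtype_mul_prod_subtype (· ∈ Set.range R) f]
  congr 1
  convert Fintype.prod_equiv (Equiv.ofInjective R hR) (fun k => f (R k)) (fun i => f i) fun _ => rfl

end splitRows

theorem norm_sq_prod_ofReal {ι : Type*} [Fintype ι] (f : ι → ℝ) :
    ‖((∏ i, f i : ℝ) : ℂ)‖ ^ 2 = ∏ i, f i ^ 2 := by
  rw [Complex.norm_real, Real.norm_eq_abs, sq_abs, prod_pow]

/-- Once all rows are processed and `ℓ'` rows are selected, the solver answers as on truncated
Gaussian samples. -/
theorem le_answerProb {κ n N M ℓ : ℕ} [NeZero N] {r : ℝ} {x : Fin ℓ → Vect n N} {s : Vect n N}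
    {ℓ' T : ℕ} {W : Fin ℓ → Fin M → ℝ} {σ : State} (hr : 0 < r) (hM : r ≤ M) (Q : Solver n N ℓ')
    {q : ℝ} (hq : ∀ y, q ≤ Q.prob s (inputState (truncWeight M r) y s))
    (h : Progress κ r x s ℓ' ℓ 0 T W σ) : weightSq W * q ≤ answerProb Q s σ := by
  classical
  have hM0 : 0 < M := by exact_mod_cast hr.trans_le hM
  have hlen : σ.sel.length = ℓ' := h.length
  have hlt : ∀ k : Fin ℓ', (k : ℕ) < σ.sel.length := fun k => by rw [hlen]; exact k.2
  have hget : ∀ k : Fin ℓ', σ.sel.getD k 0 = σ.sel[(k : ℕ)]'(hlt k) := fun k =>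
    List.getD_eq_getElem _ _ (hlt k)
  have hmem : ∀ k : Fin ℓ', σ.sel.getD k 0 ∈ σ.sel := fun k => by
    rw [hget]
    exact List.getElem_mem _
  set R : Fin ℓ' → Fin ℓ := fun k => ⟨σ.sel.getD k 0, (h.selected _ (hmem k)).1⟩ with hRdef
  have hR : R.Injective := fun a b hab => by
    have := congrArg Fin.val hab
    simp only [hRdef, hget] at this
    exact Fin.ext ((h.nodup.getElem_inj_iff).1 this)
  have hWR : ∀ k j, W (R k) j = 1 / √M * gaussianWeight r ((j : ℤ) - (M / 2 : ℕ)) := fun k =>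
    (h.selected _ (hmem k)).2.2
  set S := ∑' j, truncWeight M r j ^ 2 with hS
  have hSpos : 0 < S := (by positivity : 0 < Real.exp (-(Real.pi / 2)) / 2 * r).trans_le
    (le_tsum_truncWeight_sq hr hM)
  set E := splitRows M R hR with hE
  set a₀ : Fin ℓ' → Fin M := fun _ => ⟨0, hM0⟩
  set R' : Fin ℓ' → ℕ := fun k => σ.sel.getD k 0 with hR'
  set y : Fin ℓ' → Vect n N := fun k => x (R k) with hy
  have hRlt : ∀ k, R' k < ℓ := fun k => (R k).2
  have hrow : ∀ (a b) (k : Fin ℓ') (i : Fin n), rowMem x s ℓ (E.symm (a, b)) (R' k, i + 1) =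
      ((y k + (a k : ℤ) • s) i).val := fun a b k i => by
    have e : (E.symm (a, b)) ⟨R' k, hRlt k⟩ = a k := splitRows_symm_range hR (a, b) k
    simp only [rowMem, load, hRlt k, pointLabel, e, dite_true, Nat.add_one_ne_zero, false_and,
      if_false, Nat.add_sub_cancel, i.2, Fin.eta, sub_zero]
    rfl
  -- After erasing the selected rows nothing depends on their labels, so the arbitrary filler `a₀`
  -- may describe the rest of the memory.
  have key := sum_prob_component_ge Q s R'
    (fun a : Fin ℓ' → Fin M =>
      ((∏ k, 1 / √M * gaussianWeight r ((a k : ℤ) - (M / 2 : ℕ)) : ℝ) : ℂ))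
    (fun b : {i // i ∉ Set.range R} → Fin M => ((∏ i : {i // i ∉ Set.range R}, W i (b i) : ℝ) : ℂ))
    (fun a b => rowMem x s ℓ (E.symm (a, b)))
    (fun b => eraseRows n R' (rowMem x s ℓ (E.symm (a₀, b))))
    (pointLabel y s (M / 2 : ℕ)) ?_ ?_ ?_ ?_ σ.amp ?_
  rotate_left
  · intro b b' hbb
    funext i
    have := congrFun hbb ((i : ℕ), 0)
    have hi : ¬ ((∃ k, R' k = (i : Fin ℓ)) ∧ 0 ≤ n) := by
      rintro ⟨⟨k, hk⟩, -⟩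
      exact i.2 ⟨k, Fin.ext hk⟩
    simp only [eraseRows, if_neg hi, rowMem, load, (i : Fin ℓ).2, dite_true, if_true, pointLabel,
      sub_zero, true_and, Fin.eta, sub_left_inj] at this
    rw [hE, splitRows_symm_compl hR (a₀, b) i, splitRows_symm_compl hR (a₀, b') i] at this
    ext
    exact_mod_cast this
  · intro a b
    funext p
    simp only [eraseRows]
    split_ifs with hp
    · rfl
    · by_cases hpl : p.1 < ℓ
      · by_cases hpn : p.2 ≤ n
        · have hi : (⟨p.1, hpl⟩ : Fin ℓ) ∉ Set.range R := by
            rintro ⟨k, hk⟩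
            exact hp ⟨⟨k, congrArg Fin.val hk⟩, hpn⟩
          have e : ∀ a, (E.symm (a, b)) ⟨p.1, hpl⟩ = b ⟨⟨p.1, hpl⟩, hi⟩ := fun a =>
            splitRows_symm_compl hR (a, b) ⟨⟨p.1, hpl⟩, hi⟩
          simp only [rowMem, load, hpl, dite_true, pointLabel, e]
        · have h0 : p.2 ≠ 0 := by lia
          have h1 : ¬ p.2 - 1 < n := by lia
          simp only [rowMem, load, hpl, dite_true, h0, h1, if_false, dite_false, false_and]
      · simp only [rowMem, load, hpl, dite_false, and_false, if_false]
  · intro a b k i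
    simp only [hrow]
    exact ⟨by positivity, by exact_mod_cast ZMod.val_lt _⟩
  · intro a b
    funext k
    have e : (E.symm (a, b)) ⟨R' k, hRlt k⟩ = a k := splitRows_symm_range hR (a, b) k
    refine Prod.ext ?_ ?_
    · simp only [labels, rowMem, load, hRlt k, dite_true, if_true, pointLabel, e, true_and,
        sub_zero]
    · funext i
      simp only [labels, hrow, pointLabel]
      rw [Int.cast_natCast, ZMod.natCast_zmod_val]
  · rw [h.amp, productKet, ← E.symm.sum_comp, Fintype.sum_prod_type]
    refine sum_congr rfl fun a _ => sum_congr rfl fun b _ => ?_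
    rw [← Complex.ofReal_mul, ← prod_range_mul_prod_compl hR]
    have e1 : ∏ k, W (R k) (E.symm (a, b) (R k)) =
        ∏ k, 1 / √M * gaussianWeight r ((a k : ℤ) - (M / 2 : ℕ)) :=
      prod_congr rfl fun k _ => by rw [hWR, hE, splitRows_symm_range hR (a, b) k]
    have e2 : ∏ i : {i // i ∉ Set.range R}, W i (E.symm (a, b) i) =
        ∏ i : {i // i ∉ Set.range R}, W i (b i) :=
      prod_congr rfl fun i _ => by rw [hE, splitRows_symm_compl hR (a, b) i]
    rw [e1, e2]
  -- The accepted amplitudes `ρ_r(j)/√M` are `√S/√M` times the normalized truncated ones; the base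
  -- points are shifted by `⌊M/2⌋ s`.
  have hstate : (∑ a : Fin ℓ' → Fin M,
      ((∏ k, 1 / √M * gaussianWeight r ((a k : ℤ) - (M / 2 : ℕ)) : ℝ) : ℂ) •
        (lp.single 2 (pointLabel y s (M / 2 : ℕ) a) (1 : ℂ) : Samples n N ℓ')) =
      (((√S / √M) ^ ℓ' : ℝ) : ℂ) •
        inputState (truncWeight M r) (fun k => y k + ((M / 2 : ℕ) : ℤ) • s) s := by
    rw [inputState_eq_sum (M := M) _ _ (fun j hj => truncWeight_eq_zero r hj), smul_sum]
    refine sum_congr rfl fun a _ => ?_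
    rw [smul_smul, ← Complex.ofReal_mul]
    congr 2
    have hp : (√S / √M) ^ ℓ' = ∏ k : Fin ℓ', √S / √(M : ℝ) := by
      rw [prod_const, card_univ, Fintype.card_fin]
    rw [hp, ← prod_mul_distrib]
    refine prod_congr rfl fun k _ => ?_
    rw [truncWeight_fin, ← hS]
    have := Real.sqrt_pos.2 hSpos
    field_simp
  -- The factor `(S/M) ^ ℓ'` is the share of the selected rows in the branch probability and matches
  -- the squared scalar in `hstate`.
  have hweight : weightSq W = (S / M) ^ ℓ' *
      ∑ b : {i // i ∉ Set.range R} → Fin M, ‖((∏ i : {i // i ∉ Set.range R}, W i (b i) : ℝ) : ℂ)‖ ^ 2 := by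
    rw [weightSq, ← prod_range_mul_prod_compl hR]
    congr 1
    · have : ∀ k : Fin ℓ', ∑ j, W (R k) j ^ 2 = S / M := fun k => by
        simp only [hWR, mul_pow, ← mul_sum]
        rw [← tsum_truncWeight_sq, ← hS, div_pow, Real.sq_sqrt (Nat.cast_nonneg M), one_pow]
        ring
      simp only [this, prod_const, card_univ, Fintype.card_fin]
    · rw [prod_univ_sum, Fintype.piFinset_univ]
      simp only [norm_sq_prod_ofReal]
  rw [hstate, Q.prob_smul] at key
  have hnorm : ‖(((√S / √M) ^ ℓ' : ℝ) : ℂ)‖ ^ 2 = (S / M) ^ ℓ' := by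
    rw [Complex.norm_real, Real.norm_eq_abs, sq_abs, ← pow_mul, mul_comm, pow_mul, div_pow,
      Real.sq_sqrt hSpos.le, Real.sq_sqrt (Nat.cast_nonneg M)]
  rw [hnorm] at key
  rw [answerProb, if_pos ⟨hlen, h.nodup⟩]
  refine le_trans ?_ key
  have hq' := hq fun k => y k + ((M / 2 : ℕ) : ℤ) • s
  calc weightSq W * q ≤ weightSq W * _ := by
        refine mul_le_mul_of_nonneg_left hq' ?_
        rw [hweight]
        positivity
    _ = _ := by rw [hweight]; ring

/-! ### The loop over the rows -/

/-- Measurement branches evolve independently, so an induction over the rows may continue in each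
branch separately. -/
theorem iterate_bind_eq {α : Type*} (f : α → Multiset α) (m : ℕ) (B : Multiset α) :
    (fun B : Multiset α => B.bind f)^[m] B =
      B.bind fun τ => (fun B : Multiset α => B.bind f)^[m] {τ} := by
  induction m generalizing B with
  | zero => exact ((Multiset.bind_singleton B id).trans (Multiset.map_id B)).symm
  | succ m ih =>
    simp only [Function.iterate_succ_apply]
    rw [ih, Multiset.bind_assoc]
    refine Multiset.bind_congr fun τ _ => ?_
    rw [ih ((({τ} : Multiset α)).bind f), Multiset.singleton_bind]

theorem Progress.tick {κ n N M ℓ : ℕ} {r : ℝ} {x : Fin ℓ → Vect n N} {s : Vect n N}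
    {ℓ' k t T : ℕ} {W : Fin ℓ → Fin M → ℝ} {σ : State} (h : Progress κ r x s ℓ' k t T W σ) :
    Progress κ r x s ℓ' k t (T + 1) W σ.tick :=
  { h with time := Nat.succ_le_succ h.time }

theorem weightSq_nonneg {M ℓ : ℕ} (W : Fin ℓ → Fin M → ℝ) : 0 ≤ weightSq W :=
  prod_nonneg fun _ _ => sum_nonneg fun _ _ => sq_nonneg _

/-- The probability that a uniform sample is accepted. -/
noncomputable def acceptProb (M : ℕ) (r : ℝ) : ℝ := (∑' j, truncWeight M r j ^ 2) / M

theorem sum_outcomeFactor_zero {M : ℕ} (r : ℝ) :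
    ∑ j : Fin M, (1 / √M * outcomeFactor r 0 j) ^ 2 = acceptProb M r := by
  simp only [outcomeFactor_zero, mul_pow, ← mul_sum]
  rw [← tsum_truncWeight_sq, div_pow, Real.sq_sqrt (Nat.cast_nonneg M), one_pow, acceptProb]
  ring

theorem sum_uniform {M : ℕ} (hM : 0 < M) : ∑ _j : Fin M, (1 / √M : ℝ) ^ 2 = 1 := by
  have : (0 : ℝ) < M := Nat.cast_pos.2 hM
  rw [sum_const, card_univ, Fintype.card_fin, div_pow, Real.sq_sqrt this.le, one_pow, nsmul_eq_mul]
  field_simp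

theorem sum_outcomeFactor_one {M : ℕ} (hM : 0 < M) (r : ℝ) :
    ∑ j : Fin M, (1 / √M * outcomeFactor r 1 j) ^ 2 = 1 - acceptProb M r := by
  rw [← sum_outcomeFactor_zero, eq_sub_iff_add_eq, ← sum_add_distrib]
  refine (sum_congr rfl fun j _ => ?_).trans (sum_uniform hM)
  rw [mul_pow, mul_pow, ← mul_add, add_comm, outcomeFactor_sq_add, mul_one]

theorem acceptProb_nonneg (M : ℕ) (r : ℝ) : 0 ≤ acceptProb M r :=
  div_nonneg (tsum_nonneg fun _ => sq_nonneg _) (Nat.cast_nonneg M)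

theorem acceptProb_le_one {M : ℕ} (hM : 0 < M) (r : ℝ) : acceptProb M r ≤ 1 := by
  have h : 0 ≤ ∑ j : Fin M, (1 / √M * outcomeFactor r 1 j) ^ 2 := sum_nonneg fun _ _ => sq_nonneg _
  rw [sum_outcomeFactor_one hM] at h
  linarith

section loop

variable {κ n N M ℓ : ℕ} {r : ℝ} {x : Fin ℓ → Vect n N} {s : Vect n N} {ℓ' : ℕ}

theorem Progress.weightSq_updateWeight_zero {k t T : ℕ} {W : Fin ℓ → Fin M → ℝ} {σ : State}
    (hM : 0 < M) (h : Progress κ r x s ℓ' k t T W σ) (hk : k < ℓ) :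
    weightSq (updateWeight r W ⟨k, hk⟩ 0) = acceptProb M r * weightSq W := by
  refine weightSq_update W _ _ ?_ ?_
  · simp only [h.rest ⟨k, hk⟩ le_rfl, sum_uniform hM]
  · simp only [h.rest ⟨k, hk⟩ le_rfl, sum_outcomeFactor_zero]

theorem Progress.weightSq_updateWeight_one {k t T : ℕ} {W : Fin ℓ → Fin M → ℝ} {σ : State}
    (hM : 0 < M) (h : Progress κ r x s ℓ' k t T W σ) (hk : k < ℓ) :
    weightSq (updateWeight r W ⟨k, hk⟩ 1) = (1 - acceptProb M r) * weightSq W := by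
  refine weightSq_update W _ _ ?_ ?_
  · simp only [h.rest ⟨k, hk⟩ le_rfl, sum_uniform hM]
  · simp only [h.rest ⟨k, hk⟩ le_rfl, sum_outcomeFactor_one hM]

/-- Each row costs at most `3 M + 10` steps plus one tick of the loop. -/
theorem time_loop_le (hκ : 0 < κ) (hr : 0 < r) (hM : (M : ℝ) = √κ * r) (m : ℕ) :
    ∀ {k t T : ℕ} {W : Fin ℓ → Fin M → ℝ} {σ : State}, k + m = ℓ →
      Progress κ r x s ℓ' k t T W σ →
      ∀ τ ∈ (fun B : Multiset State => B.bind fun τ => exec processRow τ.tick)^[m] {σ},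
        τ.time ≤ T + m * (3 * M + 11) := by
  induction m with
  | zero =>
    intro k t T W σ _ h τ hτ
    obtain rfl := Multiset.mem_singleton.1 hτ
    simpa using h.time
  | succ m ih =>
    intro k t T W σ hkm h τ hτ
    obtain ⟨Z, ρ, hexec, -, hprog, -⟩ := exec_processRow hκ hr hM h.tick (by lia : k < ℓ)
    rw [Function.iterate_succ_apply, Multiset.singleton_bind, hexec, iterate_bind_eq,
      Multiset.mem_bind] at hτ
    obtain ⟨τ', hτ', hmem⟩ := hτ
    obtain ⟨z, hz, rfl⟩ := Multiset.mem_map.1 hτ'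
    refine (ih (by lia) (hprog z hz) τ hmem).trans_eq ?_
    ring

/-- Failing to select `t` of `m` rows has probability at most `(2 ^ t - 1) (1 - p / 2) ^ m`. -/
theorem le_sum_answerProb_loop [NeZero N] (hκ : 0 < κ) (hr : 0 < r) (hM : (M : ℝ) = √κ * r)
    (hrM : r ≤ M) (Q : Solver n N ℓ') {q : ℝ} (hq0 : 0 ≤ q)
    (hq : ∀ y, q ≤ Q.prob s (inputState (truncWeight M r) y s)) (m : ℕ) :
    ∀ {k t T : ℕ} {W : Fin ℓ → Fin M → ℝ} {σ : State}, k + m = ℓ →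
      Progress κ r x s ℓ' k t T W σ →
      weightSq W * (q * (1 - (2 ^ t - 1) * (1 - acceptProb M r / 2) ^ m)) ≤
        (((fun B : Multiset State => B.bind fun τ => exec processRow τ.tick)^[m] {σ}).map
          (answerProb Q s)).sum := by
  have hM0 : 0 < M := by exact_mod_cast hr.trans_le hrM
  induction m with
  | zero =>
    intro k t T W σ hk h
    obtain rfl : k = ℓ := by simpa using hk
    rw [Function.iterate_zero_apply, Multiset.map_singleton, Multiset.sum_singleton]
    rcases t with _ | t
    · simpa using le_answerProb hr hrM Q hq h
    -- No rows are left but some are still wanted: `2 ^ (t + 1) - 1 ≥ 1` makes the claimed lower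
    -- bound nonpositive.
    · refine le_trans (mul_nonpos_of_nonneg_of_nonpos (weightSq_nonneg W)
        (mul_nonpos_of_nonneg_of_nonpos hq0 ?_)) (answerProb_nonneg Q s σ)
      have : (1 : ℝ) ≤ 2 ^ t := one_le_pow₀ one_le_two
      rw [pow_succ, pow_zero, mul_one]
      linarith
  | succ m ih =>
    intro k t T W σ hkm h
    have hk : k < ℓ := by lia
    obtain ⟨Z, ρ, hexec, hsub, hprog, hzero⟩ := exec_processRow hκ hr hM h.tick hk
    rw [Function.iterate_succ_apply, Multiset.singleton_bind, hexec, iterate_bind_eq,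
      Multiset.bind_map, Multiset.map_bind, Multiset.sum_bind]
    change _ ≤ ∑ z ∈ Z, _
    set p := acceptProb M r with hp
    have hp0 : 0 ≤ p := acceptProb_nonneg M r
    have hp1 : p ≤ 1 := acceptProb_le_one hM0 r
    set L : ℤ → ℝ := fun z => weightSq (updateWeight r W ⟨k, hk⟩ z) *
      (q * (1 - (2 ^ (if z = 0 then t - 1 else t) - 1) * (1 - p / 2) ^ m)) with hL
    calc weightSq W * (q * (1 - (2 ^ t - 1) * (1 - p / 2) ^ (m + 1))) ≤ L 0 + L 1 := by
          simp only [hL, h.weightSq_updateWeight_zero hM0 hk, h.weightSq_updateWeight_one hM0 hk,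
            if_true, one_ne_zero, if_false, ← hp]
          have hpow : 0 ≤ (1 - p / 2) ^ m := pow_nonneg (by linarith) m
          -- The failure bound passes through one Bernoulli trial because `p (2^(t-1) - 1) + (1 -
          -- p)(2^t - 1) = 2^t (1 - p/2) - 1 ≤ (2^t - 1)(1 - p/2)` for `t ≥ 1`. Here `1 - p/2` is
          -- the mean of `2^(-X)` for one trial `X`, and the `-1` makes the bound vanish at `t = 0`.
          have hkey : (1 - (2 ^ t - 1) * (1 - p / 2) ^ (m + 1) : ℝ) ≤
              p * (1 - (2 ^ (t - 1) - 1) * (1 - p / 2) ^ m) +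
                (1 - p) * (1 - (2 ^ t - 1) * (1 - p / 2) ^ m) := by
            rcases t with _ | t
            · simp
            · rw [Nat.add_sub_cancel, pow_succ (2 : ℝ) t, pow_succ (1 - p / 2) m]
              have : 0 ≤ p * (1 - p / 2) ^ m := mul_nonneg hp0 hpow
              linarith
          have := mul_le_mul_of_nonneg_left (mul_le_mul_of_nonneg_left hkey hq0) (weightSq_nonneg W)
          linarith
      _ = ∑ z ∈ ({0, 1} : Finset ℤ), L z := (sum_pair zero_ne_one).symm
      _ = ∑ z ∈ Z, L z := (sum_subset hsub fun z hz hzZ => by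
          simp only [hL, hzero z hz hzZ, zero_mul]).symm
      _ ≤ _ := sum_le_sum fun z hz => ih (by lia) (hprog z hz)

end loop

/-! ### The start of the program -/

theorem exec_halve {M : ℕ} {σ : State} (h3 : σ.v 3 = M) (h9 : σ.v 9 = 1) (h10 : σ.v 10 = 0)
    (h11 : σ.v 11 = M) :
    ∃ τ, exec halve σ = {τ} ∧ τ.v 11 = (M / 2 : ℕ) ∧
      (∀ i, i ≠ 10 → i ≠ 11 → i ≠ 17 → τ.v i = σ.v i) ∧ τ.sel = σ.sel ∧ τ.amp = σ.amp ∧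
      τ.time ≤ σ.time + 1 + 4 * M := by
  -- Units move from register `11` to register `10` until the former is no larger, which happens
  -- after `M - ⌊M/2⌋` moves; the remaining rounds only write to the scratch register `17`.
  have key : ∀ t : ℕ, ∃ τ, (fun B : Multiset State => B.bind fun τ =>
      exec (.ite 11 10 (.set 17 0) (.seq (.add 10 9) (.sub 11 9))) τ.tick)^[t] {σ.tick} = {τ} ∧
      τ.v 10 = min t (M - M / 2 : ℕ) ∧ τ.v 11 = M - min (t : ℤ) (M - M / 2 : ℕ) ∧
      (∀ i, i ≠ 10 → i ≠ 11 → i ≠ 17 → τ.v i = σ.v i) ∧ τ.sel = σ.sel ∧ τ.amp = σ.amp ∧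
      τ.time ≤ σ.time + 1 + 4 * t := by
    intro t
    induction t with
    | zero => exact ⟨σ.tick, rfl, by simp [State.tick, h10], by simp [State.tick, h11],
        fun _ _ _ _ => rfl, rfl, rfl, le_rfl⟩
    | succ t ih =>
      obtain ⟨τ, hτ, e10, e11, ev, esel, eamp, etime⟩ := ih
      rw [Function.iterate_succ_apply', hτ, Multiset.singleton_bind, exec]
      have e9 : τ.v 9 = 1 := (ev 9 (by norm_num) (by norm_num) (by norm_num)).trans h9
      by_cases hle : τ.v 11 ≤ τ.v 10
      · refine ⟨{ τ.tick.tick.tick with v := Function.update τ.v 17 0 }, ?_, ?_, ?_, ?_, esel,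
          eamp, ?_⟩
        · rw [if_pos (by exact hle), exec]
          rfl
        · change Function.update τ.v 17 0 10 = _
          rw [Function.update_of_ne (by norm_num)]
          lia
        · change Function.update τ.v 17 0 11 = _
          rw [Function.update_of_ne (by norm_num)]
          lia
        · intro i h1 h2 h3
          change Function.update τ.v 17 0 i = _
          rw [Function.update_of_ne h3, ev i h1 h2 h3]
        · simp only [State.tick]
          lia
      · refine ⟨{ τ.tick.tick.tick.tick with
          v := Function.update (Function.update τ.v 10 (τ.v 10 + 1)) 11 (τ.v 11 - 1) },
          ?_, ?_, ?_, ?_, esel, eamp, ?_⟩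
        · rw [if_neg (by exact hle)]
          simp [exec, State.tick, e9]
        · change Function.update (Function.update τ.v 10 (τ.v 10 + 1)) 11 (τ.v 11 - 1) 10 = _
          rw [Function.update_of_ne (by norm_num), Function.update_self]
          lia
        · simp only [Function.update_self]
          lia
        · intro i h1 h2 h3
          simp [h1, h2, ev i h1 h2 h3]
        · simp only [State.tick]
          lia
  obtain ⟨τ, hτ, -, e11, ev, esel, eamp, etime⟩ := key M
  refine ⟨τ, ?_, by lia, ev, esel, eamp, etime⟩
  rw [halve, exec, h3, Int.toNat_natCast]
  exact hτ

/-! ### The uniform input as a product state -/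

theorem tsum_uniformWeight_sq (M : ℕ) : ∑' j, uniformWeight M j ^ 2 = M := by
  have hinj : Function.Injective fun a : Fin M => (a : ℤ) := fun a b h => by
    ext
    simpa using h
  rw [← hinj.tsum_eq, tsum_fintype]
  · simp [uniformWeight]
  · intro j hj
    by_contra h
    refine hj ?_
    have : ¬ (0 ≤ j ∧ j < M) := fun hj' => h ⟨⟨j.toNat, by lia⟩, by simp only; lia⟩
    simp only [uniformWeight, if_neg this]
    norm_num

theorem initial_amp {n N M ℓ : ℕ} (κ ℓ' : ℕ) (x : Fin ℓ → Vect n N) (s : Vect n N) :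
    (initial κ M ℓ' (inputState (uniformWeight M) x s)).amp =
      productKet x s 0 fun _ (_ : Fin M) => 1 / √M := by
  classical
  -- The `finsum` defining the memory is a genuine sum only for finite support; a nonzero amplitude
  -- forces every label into `{0, …, M - 1}` and fixes its vector.
  have hsupp : Function.support (fun h : Fin ℓ → Label n N =>
      Finsupp.single (load h) (inputState (uniformWeight M) x s h)) ⊆
      (univ.map ⟨_, pointLabel_injective (M := M) x s 0⟩ : Finset (Fin ℓ → Label n N)) := by
    intro h hh
    have hne : ∏ k, sampleAmp (uniformWeight M) (x k) s (h k) ≠ 0 := fun h0 => hh <| by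
      change Finsupp.single (load h) (∏ k, sampleAmp (uniformWeight M) (x k) s (h k)) = 0
      rw [h0, Finsupp.single_zero]
    have hk : ∀ k, (h k).2 = x k + (h k).1 • s ∧ 0 ≤ (h k).1 ∧ (h k).1 < M := fun k => by
      have := prod_ne_zero_iff.1 hne k (mem_univ k)
      rw [sampleAmp] at this
      split_ifs at this with h2
      · refine ⟨h2, ?_⟩
        by_contra h3
        rw [uniformWeight, if_neg h3, zero_div] at this
        exact this Complex.ofReal_zero
      · exact absurd rfl this
    rw [coe_map, Set.mem_image]
    refine ⟨fun k => ⟨(h k).1.toNat, by have := hk k; lia⟩, by simp, ?_⟩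
    funext k
    obtain ⟨h1, h2, h3⟩ := hk k
    have e : (((h k).1.toNat : ℕ) : ℤ) = (h k).1 := Int.toNat_of_nonneg h2
    refine Prod.ext ?_ ?_
    · simp [pointLabel, e]
    · simp only [pointLabel, Function.Embedding.coeFn_mk, e, h1]
  change ∑ᶠ h : Fin ℓ → Label n N, Finsupp.single (load h) (inputState (uniformWeight M) x s h) = _
  rw [finsum_eq_sum_of_support_subset _ hsupp, sum_map, productKet]
  refine sum_congr rfl fun a _ => ?_
  rw [rowMem_zero, Finsupp.smul_single_one]
  congr 1
  rw [Complex.ofReal_prod]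
  change ∏ k, sampleAmp (uniformWeight M) (x k) s (pointLabel x s 0 a k) = _
  refine prod_congr rfl fun k _ => ?_
  have h1 : uniformWeight M (a k : ℤ) = 1 := if_pos (by have := (a k).2; lia)
  simp only [pointLabel, sampleAmp, tsum_uniformWeight_sq, sub_zero, h1, if_true]

theorem exec_setup {κ n N M ℓ : ℕ} (r : ℝ) (ℓ' : ℕ) (x : Fin ℓ → Vect n N) (s : Vect n N) :
    ∃ τ, exec setup (initial κ M ℓ' (inputState (uniformWeight M) x s)) = {τ} ∧ τ.v 4 = ℓ ∧
      Progress κ r x s ℓ' 0 ℓ' (4 * M + 7) (fun _ (_ : Fin M) => 1 / √M) τ := by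
  set σ := initial κ M ℓ' (inputState (uniformWeight M) x s) with hσ
  have hv : ∀ a, σ.v a = (([κ, n, N, M, ℓ, ℓ'].getD a 0 : ℕ) : ℤ) := fun _ => rfl
  set u : ℕ → ℤ := Function.update (Function.update σ.v 9 1) 16 (-1) with hu
  set u' : ℕ → ℤ := Function.update u 8 (u 8 + u 1) with hu'
  set v : ℕ → ℤ := Function.update u' 8 (u' 8 + u' 9) with hv'
  set w : ℕ → ℤ := Function.update v 11 (v 11 + v 3) with hw
  obtain ⟨τ, hτ, e11, ev, esel, eamp, etime⟩ := exec_halve (M := M)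
    (σ := { v := w, sel := [], amp := σ.amp, time := 5 }) (by simp [hu, hu', hv', hw, hv])
    (by simp [hu, hu', hv', hw]) (by simp [hu, hu', hv', hw, hv]) (by simp [hu, hu', hv', hw, hv])
  have hτv : ∀ i, i ≠ 10 → i ≠ 11 → i ≠ 17 → τ.v i = w i := ev
  have h15 : τ.v 15 = 0 := by
    rw [hτv 15 (by norm_num) (by norm_num) (by norm_num)]
    simp [hu, hu', hv', hw, hv]
  refine ⟨{ τ.tick with v := Function.update τ.v 15 (-((M / 2 : ℕ) : ℤ)) }, ?_, ?_, ?_⟩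
  · rw [setup, exec, exec, Multiset.singleton_bind, exec, exec, Multiset.singleton_bind, exec, exec,
      Multiset.singleton_bind, exec, exec, Multiset.singleton_bind, exec, exec,
      Multiset.singleton_bind, exec]
    refine (congrArg (fun B : Multiset State => B.bind (exec (.sub 15 11))) hτ).trans ?_
    rw [Multiset.singleton_bind, exec, h15, e11, zero_sub]
  · simp [hτv, hu, hu', hv', hw, hv]
  · constructor
    case amp => exact eamp.trans (initial_amp κ ℓ' x s)
    case nodup => simp [State.tick, esel]
    case length => simp [State.tick, esel]
    case selected => simp [State.tick, esel]
    case rest => intros; rfl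
    case time =>
      simp only [State.tick] at etime ⊢
      lia
    all_goals simp [hτv, hu, hu', hv', hw, hv]

/-! ### The error of the reduction -/

theorem exp_neg_mul_le_two_rpow {a b : ℝ} (ha : 0 ≤ a) (hab : a ≤ b) (κ : ℕ) :
    Real.exp (-(b * κ)) ≤ (2 : ℝ) ^ (-(a * κ)) := by
  rw [Real.rpow_def_of_pos two_pos, Real.exp_le_exp]
  have h2 : Real.log 2 ≤ 1 := by linarith [Real.log_two_lt_d9]
  have hκ : (0 : ℝ) ≤ κ := Nat.cast_nonneg κ
  have h1 : Real.log 2 * (a * κ) ≤ 1 * (a * κ) := by gcongr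
  have h3 : a * κ ≤ b * κ := by gcongr
  linarith

/-- The constant in the lower bound for the acceptance probability. -/
noncomputable def acceptConst : ℝ := Real.exp (-(Real.pi / 2)) / 2

theorem acceptConst_pos : 0 < acceptConst := by
  rw [acceptConst]
  positivity

theorem le_acceptProb {κ M : ℕ} {r : ℝ} (hr : 0 < r) (hM : (M : ℝ) = √κ * r) (hrM : r ≤ M) :
    acceptConst / √κ ≤ acceptProb M r := by
  have hM0 : (0 : ℝ) < M := hr.trans_le hrM
  have hκ : 0 < √(κ : ℝ) := by
    by_contra h
    rw [hM] at hM0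
    exact absurd hM0 (not_lt.2 (mul_nonpos_of_nonpos_of_nonneg (not_lt.1 h) hr.le))
  calc acceptConst / √κ = acceptConst * r / M := by
        rw [hM]
        field_simp
    _ ≤ acceptProb M r := by
        rw [acceptProb]
        gcongr
        exact le_tsum_truncWeight_sq hr hrM

/-- The probability that too few samples are accepted. -/
theorem min_one_failure_le {κ ℓ ℓ' : ℕ} {p c C : ℝ} (hκ : 0 < κ) (hc : 0 ≤ c) (hC : 0 < C)
    (hp : c / √κ ≤ p) (hp1 : p ≤ 1) (hℓ : (ℓ' : ℝ) ≤ C * ((ℓ : ℝ) / (κ : ℝ) ^ (3 / 2 : ℝ))) :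
    min 1 ((2 ^ ℓ' - 1) * (1 - p / 2) ^ ℓ) ≤ 2 * Real.exp (-(c / (2 * C) * κ)) := by
  rcases Nat.eq_zero_or_pos ℓ' with rfl | hpos
  · rw [pow_zero, sub_self, zero_mul]
    exact (min_le_right _ _).trans (by positivity)
  have hκ' : (0 : ℝ) < κ := Nat.cast_pos.2 hκ
  have hs : 0 < √(κ : ℝ) := Real.sqrt_pos.2 hκ'
  have h32 : (κ : ℝ) ^ (3 / 2 : ℝ) = κ * √κ := by
    rw [Real.sqrt_eq_rpow, ← Real.rpow_one_add' hκ'.le (by norm_num)]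
    norm_num
  -- Of `κ^(3/2) = κ √κ`, the factor `√κ` pays for the acceptance probability and `κ` remains as the
  -- exponent per requested sample.
  have hexp : ℓ' * (c / (2 * C) * κ) ≤ p / 2 * ℓ := by
    rw [h32] at hℓ
    calc ℓ' * (c / (2 * C) * κ) ≤ C * (ℓ / (κ * √κ)) * (c / (2 * C) * κ) := by gcongr
      _ = c / √κ / 2 * ℓ := by field_simp
      _ ≤ p / 2 * ℓ := by gcongr
  set X := 2 * Real.exp (-(c / (2 * C) * κ)) with hX
  have hX0 : 0 ≤ X := by positivity
  have hf : (2 ^ ℓ' - 1) * (1 - p / 2) ^ ℓ ≤ X ^ ℓ' := by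
    have h1 : (1 - p / 2) ^ ℓ ≤ Real.exp (-(p / 2)) ^ ℓ :=
      pow_le_pow_left₀ (by linarith) (Real.one_sub_le_exp_neg _) ℓ
    calc (2 ^ ℓ' - 1) * (1 - p / 2) ^ ℓ ≤ 2 ^ ℓ' * Real.exp (-(p / 2)) ^ ℓ :=
          mul_le_mul (by linarith) h1 (pow_nonneg (by linarith) ℓ) (by positivity)
      _ ≤ 2 ^ ℓ' * Real.exp (-(c / (2 * C) * κ)) ^ ℓ' := by
          rw [← Real.exp_nat_mul, ← Real.exp_nat_mul]
          gcongr 2 ^ ℓ' * ?_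
          rw [Real.exp_le_exp]
          linarith
      _ = X ^ ℓ' := by rw [hX, mul_pow]
  -- As `ℓ' ≥ 1`, `X ^ ℓ' ≤ X` when `X ≤ 1`; otherwise the trivial bound `1` is below `X`.
  rcases le_total X 1 with h | h
  · exact (min_le_right _ _).trans (hf.trans (pow_le_of_le_one hX0 h hpos.ne'))
  · exact (min_le_left _ _).trans h

/-- A solver answers almost as well on truncated Gaussian samples. -/
theorem sub_le_prob_truncWeight {κ n N M ℓ : ℕ} {r δ : ℝ} (hr : 0 < r) (hM : (M : ℝ) = √κ * r)
    (hrM : r ≤ M) (Q : Solver n N ℓ) (s : Vect n N) (y : Fin ℓ → Vect n N)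
    (hδ : δ ≤ Q.prob s (inputState (gaussianWeight r) y s)) :
    δ - 4 * (ℓ + 1) * Real.exp (-(Real.pi / 8 * κ)) ≤
      Q.prob s (inputState (truncWeight M r) y s) := by
  have h1 := Q.prob_sub_le s (norm_inputState_le_one (gaussianWeight r) y s)
    (norm_inputState_le_one (truncWeight M r) y s)
  have h2 := norm_inputState_sub_sq_le hr hrM (one_sub_le_tsum_truncWeight_sq_div hr hM) y s
  -- The square root halves the exponent `πκ/4`; the factor `2` from `Solver.prob_sub_le` then gives
  -- the constant `4`.
  have h3 : ‖inputState (truncWeight M r) y s - inputState (gaussianWeight r) y s‖ ≤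
      2 * (ℓ + 1) * Real.exp (-(Real.pi / 8 * κ)) := by
    refine (sq_le_sq₀ (norm_nonneg _) (by positivity)).1 (h2.trans ?_)
    have he : Real.exp (-(Real.pi / 8 * κ)) ^ 2 = Real.exp (-(Real.pi / 4 * κ)) := by
      rw [← Real.exp_nat_mul]
      congr 1
      push_cast
      ring
    rw [mul_pow, he]
    have hs : √2 ≤ 2 := Real.sqrt_le_iff.2 ⟨by norm_num, by norm_num⟩
    calc 2 * (ℓ * (√2 * Real.exp (-(Real.pi / 4 * κ))))
        ≤ 2 * (ℓ * (2 * Real.exp (-(Real.pi / 4 * κ)))) := by gcongr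
      _ = (4 * ℓ) * Real.exp (-(Real.pi / 4 * κ)) := by ring
      _ ≤ (2 * (ℓ + 1)) ^ 2 * Real.exp (-(Real.pi / 4 * κ)) := by
          gcongr
          have : (0 : ℝ) ≤ ℓ := Nat.cast_nonneg ℓ
          nlinarith
  linarith

theorem exec_reduction {κ n N M ℓ : ℕ} (r : ℝ) (ℓ' : ℕ) (x : Fin ℓ → Vect n N) (s : Vect n N) :
    ∃ τ, exec reduction (initial κ M ℓ' (inputState (uniformWeight M) x s)) =
        (fun B : Multiset State => B.bind fun τ => exec processRow τ.tick)^[ℓ] {τ} ∧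
      Progress κ r x s ℓ' 0 ℓ' (4 * M + 8) (fun _ (_ : Fin M) => 1 / √M) τ := by
  obtain ⟨τ, hτ, h4, hprog⟩ := exec_setup (κ := κ) (M := M) r ℓ' x s
  refine ⟨τ.tick, ?_, hprog.tick⟩
  rw [reduction, exec, hτ, Multiset.singleton_bind, exec, h4, Int.toNat_natCast]

theorem reductionProb_nonneg {n N ℓ : ℕ} (P : Prog) (Q : Solver n N ℓ) (s : Vect n N) (σ : State) :
    0 ≤ reductionProb P Q s σ := by
  refine Multiset.sum_nonneg fun a ha => ?_
  obtain ⟨τ, -, rfl⟩ := Multiset.mem_map.1 ha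
  exact answerProb_nonneg Q s τ

/-- Two losses add up: `4 (ℓ' + 1) E` from truncation and `2 E` from accepting too few samples,
together at most `6 (ℓ' + 1) E`. -/
theorem le_reductionProb {κ n N M ℓ ℓ' : ℕ} {r C δ : ℝ} (hκ : 0 < κ) (hN : 1 < N)
    (hC : 0 < C) (hr : 0 < r) (hM : (M : ℝ) = √κ * r)
    (hℓ : (ℓ' : ℝ) ≤ C * ((ℓ : ℝ) / (κ : ℝ) ^ (3 / 2 : ℝ))) (s : Vect n N)
    (x : Fin ℓ → Vect n N) (Q : Solver n N ℓ')
    (hδ : ∀ y, δ ≤ Q.prob s (inputState (gaussianWeight r) y s)) :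
    δ - 6 * (ℓ' + 1) * (2 : ℝ) ^ (-(min (Real.pi / 8) (acceptConst / (2 * C)) * κ)) ≤
      reductionProb reduction Q s (initial κ M ℓ' (inputState (uniformWeight M) x s)) := by
  have : NeZero N := ⟨by lia⟩
  have hrM : r ≤ M := by
    rw [hM]
    exact le_mul_of_one_le_left hr.le (Real.one_le_sqrt.2 (by exact_mod_cast hκ))
  have hM0 : 0 < M := by exact_mod_cast hr.trans_le hrM
  set a := min (Real.pi / 8) (acceptConst / (2 * C)) with ha
  have ha0 : 0 ≤ a := le_min (by positivity) (div_nonneg acceptConst_pos.le (by positivity))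
  set E := (2 : ℝ) ^ (-(a * κ)) with hE
  set f := ((2 : ℝ) ^ ℓ' - 1) * (1 - acceptProb M r / 2) ^ ℓ with hf
  -- Clipped at `0`, since the loop bound needs a nonnegative `q`.
  set q := max 0 (δ - 4 * (ℓ' + 1) * Real.exp (-(Real.pi / 8 * κ))) with hq
  have hqle : ∀ y, q ≤ Q.prob s (inputState (truncWeight M r) y s) := fun y =>
    max_le (Q.prob_nonneg s _) (sub_le_prob_truncWeight hr hM hrM Q s y (hδ y))
  have hq1 : q ≤ 1 := (hqle 0).trans (Q.prob_le_one s (norm_inputState_le_one _ _ _))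
  have hq0 : 0 ≤ q := le_max_left _ _
  have hfail : min 1 f ≤ 2 * E := (min_one_failure_le hκ acceptConst_pos.le hC
    (le_acceptProb hr hM hrM) (acceptProb_le_one hM0 r) hℓ).trans
    (mul_le_mul_of_nonneg_left (exp_neg_mul_le_two_rpow ha0 (min_le_right _ _) κ) zero_le_two)
  have hval : q * (1 - f) ≤
      reductionProb reduction Q s (initial κ M ℓ' (inputState (uniformWeight M) x s)) := by
    obtain ⟨τ, hτ, hprog⟩ := exec_reduction (κ := κ) (M := M) r ℓ' x s
    have h := le_sum_answerProb_loop hκ hr hM hrM Q hq0 hqle ℓ (zero_add ℓ) hprog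
    have hw : weightSq (fun (_ : Fin ℓ) (_ : Fin M) => 1 / √(M : ℝ)) = 1 := by
      rw [weightSq, sum_uniform hM0, prod_const_one]
    rwa [hw, one_mul, ← hτ] at h
  have hlow : q - min 1 f ≤
      reductionProb reduction Q s (initial κ M ℓ' (inputState (uniformWeight M) x s)) := by
    rcases min_cases 1 f with ⟨h, -⟩ | ⟨h, -⟩ <;> rw [h]
    · exact (sub_nonpos.2 hq1).trans (reductionProb_nonneg _ _ _ _)
    · refine le_trans ?_ hval
      have hf0 : 0 ≤ f := mul_nonneg (sub_nonneg.2 (one_le_pow₀ one_le_two))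
        (pow_nonneg (by linarith [acceptProb_le_one hM0 r]) ℓ)
      have := mul_le_mul_of_nonneg_right hq1 hf0
      linarith
  have hdist : 4 * (ℓ' + 1) * Real.exp (-(Real.pi / 8 * κ)) ≤ 4 * (ℓ' + 1) * E := by
    gcongr
    exact exp_neg_mul_le_two_rpow ha0 (min_le_left _ _) κ
  have hqδ : δ - 4 * (ℓ' + 1) * Real.exp (-(Real.pi / 8 * κ)) ≤ q := le_max_right _ _
  have hE0 : 0 ≤ ℓ' * E := by positivity
  linarith

/-- The setup and loop-entry cost `4 M + 8` is charged to the rows, of which there is at least one,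
on top of `3 M + 11` per row. -/
theorem time_reduction_le {κ n N M ℓ : ℕ} {r : ℝ} (hκ : 0 < κ) (hr : 0 < r)
    (hM : (M : ℝ) = √κ * r) (hℓ : 0 < ℓ) (ℓ' : ℕ) (x : Fin ℓ → Vect n N) (s : Vect n N) :
    ∀ σ ∈ exec reduction (initial κ M ℓ' (inputState (uniformWeight M) x s)),
      σ.time ≤ ℓ * (7 * M + 19) := by
  intro σ hσ
  obtain ⟨τ, hτ, hprog⟩ := exec_reduction (κ := κ) (M := M) r ℓ' x s
  rw [hτ] at hσ
  have h := time_loop_le hκ hr hM ℓ (zero_add ℓ) hprog σ hσ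
  have : 1 * (4 * M + 8) ≤ ℓ * (4 * M + 8) := Nat.mul_le_mul_right _ hℓ
  linarith

end EDCP

theorem mainTheorem8 :
    ∃ P : EDCP.Prog, ∀ (d : ℕ) (C : ℝ), 0 < C →
      ∃ (p : Polynomial ℕ) (A a : ℝ), 0 < a ∧
        ∀ (κ n N M ℓ ℓ' : ℕ) (r : ℝ),
          0 < κ → 0 < n → 1 < N → 1 < M → 1 < ℓ →
          (M : ℝ) = √(κ : ℝ) * r → M ≤ κ ^ d + d →
          (ℓ' : ℝ) ≤ C * ((ℓ : ℝ) / (κ : ℝ) ^ (3 / 2 : ℝ)) →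
          ∀ (s : EDCP.Vect n N) (x : Fin ℓ → EDCP.Vect n N),
            (∀ σ ∈ EDCP.exec P
                (EDCP.initial κ M ℓ' (EDCP.inputState (EDCP.uniformWeight M) x s)),
              σ.time ≤ ℓ * p.eval κ) ∧
            ∀ (Q : EDCP.Solver n N ℓ') (δ : ℝ),
              (∀ y : Fin ℓ' → EDCP.Vect n N,
                δ ≤ Q.prob s (EDCP.inputState (EDCP.gaussianWeight r) y s)) →
              δ - A * (ℓ' + 1) * (2 : ℝ) ^ (-(a * κ)) ≤
                EDCP.reductionProb P Q s
                  (EDCP.initial κ M ℓ' (EDCP.inputState (EDCP.uniformWeight M) x s)) := by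
  -- The polynomial is the time bound `7 M + 19` per row with `M ≤ κ ^ d + d` inserted; the exponent
  -- `a` is the smaller of the truncation rate and the shortage rate.
  refine ⟨EDCP.reduction, fun d C hC => ⟨7 * (Polynomial.X ^ d + Polynomial.C d) + 19, 6,
    min (Real.pi / 8) (EDCP.acceptConst / (2 * C)),
    lt_min (by positivity) (div_pos EDCP.acceptConst_pos (by positivity)), ?_⟩⟩
  intro κ n N M ℓ ℓ' r hκ _ hN hM1 hℓ1 hM hMd hℓ' s x
  have hr : 0 < r := by
    have hM0 : (0 : ℝ) < M := by exact_mod_cast zero_lt_one.trans hM1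
    rw [hM] at hM0
    exact pos_of_mul_pos_right hM0 (Real.sqrt_nonneg _)
  refine ⟨fun σ hσ => ?_, fun Q δ hδ => EDCP.le_reductionProb hκ hN hC hr hM hℓ' s x Q hδ⟩
  refine (EDCP.time_reduction_le hκ hr hM (by lia) ℓ' x s σ hσ).trans (Nat.mul_le_mul_left ℓ ?_)
  simp only [Polynomial.eval_add, Polynomial.eval_mul, Polynomial.eval_pow, Polynomial.eval_X,
    Polynomial.eval_C, Polynomial.eval_ofNat]
  lia
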